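/- Let $\mathbb K=\mathbb R$ or $\mathbb C$, let $B,\bar B$ be Banach spaces over $\mathbb K$, and let $k\ge 3$. *Setting.* Let $q\in\{1,2,\dots\}\cup\{\infty\}$, let $G\in C^{q+2k}(B,\bar B)$, let $U\subset\mathbb K$ be an open neighbourhood of $0$, and let $z\in C^{q+2k}(U,B)$ with $z(0)=0$ (holomorphic if $\mathbb K=\mathbb C$). Put $L(\varepsilon)=G'[z(\varepsilon)]$, $\mathcal B(\varepsilon)=\tfrac12G''[z(\varepsilon)]$, $\mathcal B_0=\mathcal B(0)$, $\mathcal B_1=\mathcal B'(0)$. An element $y\in\bar B$ is a *leading coefficient of order $i$* if there are $b_0,\dots,b_i\in B$ with $L(\varepsilon)\sum_{j\le i}\varepsilon^jb_j=\varepsilon^iy+O(\varepsilon^{i+1})$; the family $L$ is *$k$-surjective* if every $y\in\bar B$ is a leading coefficient of order $k$. An element $b_0\in B$ has *rank at least $i$* if there are $b_1,\dots,b_{i-1}\in B$ with $L(\varepsilon)\sum_{j<i}\varepsilon^jb_j=O(\varepsilon^i)$. Assume that $L$ is $k$-surjective and that $$B=N_1^c\oplus\dots\oplus N_{k+1}^c\oplus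 N_{k+1},\qquad \bar B=R_1\oplus\dots\oplus R_{k+1}$$ are direct sums of closed subspaces such that $N_{i+1}^c\oplus\dots\oplus N_{k+1}^c\oplus N_{k+1}$ is the set of elements of rank at least $i$ ($0\le i\le k+1$) and $R_1\oplus\dots\oplus R_{i+1}$ is the set of leading coefficients of order $i$ ($0\le i\le k$). Let $\mathcal P_i$ be the projection of $\bar B$ to $R_i$. *Existence of Jordan chains.* There are topological isomorphisms $S_i:N_i^c\to R_i$ ($1\le i\le k+1$) and a family $p_k(\varepsilon)=I_B+\varepsilon\phi_1+\dots+\varepsilon^k\phi_k$ of bounded linear operators, $\phi_i$ having values in $N_1^c\oplus\dots\oplus N_{k+1-i}^c$, such that $$L(\varepsilon)p_k(\varepsilon)n_{i+1}^c=\varepsilon^iS_{i+1}n_{i+1}^c+O(\varepsilon^{i+1})\ (0\le i\le k),\qquad L(\varepsilon)p_k(\varepsilon)n_{k+1}=O(\varepsilon^{k+1})$$ for all $n_{i+1}^c\in N_{i+1}^c$ and $n_{k+1}\in N_{k+1}$. *Newton's Lemma.* For every $M$ there are $\delta,r>0$, depending only on $\mathbb K,B,\bar B,k,M$, such that the following holds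 for all data as above and every choice of $S_i$, $p_k$ as above for which the norms of $\mathcal P_k,\mathcal P_{k+1},S_k^{-1},S_{k+1}^{-1},\phi_1,\mathcal B_0,\mathcal B_1$ are at most $M$. Assume that $$G[z(\varepsilon)]=\varepsilon^{2k-1}\bar b(\varepsilon)\ (\varepsilon\in U)\ \text{with}\ \bar b\ \text{continuous at}\ 0,\qquad \|(\mathcal P_k+\mathcal P_{k+1})\bar b(0)\|<\delta,$$ $$\mathcal B_0\,(n_{k+1}^c+n_{k+1})^2=0\quad\text{for all } n_{k+1}^c\in N_{k+1}^c,\ n_{k+1}\in N_{k+1}.$$ For $n^c=(n_1^c,\dots,n_{k+1}^c)\in N_1^c\times\dots\times N_{k+1}^c$ and $n_{k+1}\in N_{k+1}$ consider the points of the cone $$Z(\varepsilon,n^c,n_{k+1})=z(\varepsilon)+\varepsilon^{k-1}p_k(\varepsilon)\{\varepsilon^kn_1^c+\dots+\varepsilon n_k^c+n_{k+1}^c+n_{k+1}\}.$$ Then there are $\varepsilon_0>0$ with $\{|\varepsilon|<\varepsilon_0\}\subset U$ and a $C^q$ mapping $\nu=(\nu_1,\dots,\nu_{k+1})$ from $\{|\varepsilon|<\varepsilon_0\}\times\{n_{k+1}\in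 N_{k+1}:\|n_{k+1}\|<r\}$ to $N_1^c\times\dots\times N_{k+1}^c$ such that, with $\bar n^c(\varepsilon,n_{k+1})=\varepsilon^k\nu_1+\dots+\varepsilon\nu_k+\nu_{k+1}$, $$z=z(\varepsilon)+\varepsilon^{k-1}p_k(\varepsilon)\{\bar n^c(\varepsilon,n_{k+1})+n_{k+1}\}$$ gives all solutions of $G[z]=0$ in the cone. Precisely: (a) for $|\varepsilon|<\varepsilon_0$ and $\|n_{k+1}\|<r$ one has $\|\nu_k\|,\|\nu_{k+1}\|<r$ and $G[Z(\varepsilon,\nu(\varepsilon,n_{k+1}),n_{k+1})]=0$; (b) for every $\rho>0$ there is $\varepsilon_1\in(0,\varepsilon_0]$ such that, whenever $0<|\varepsilon|<\varepsilon_1$, $\|n_{k+1}\|<r$, $\|n_k^c\|,\|n_{k+1}^c\|<r$ and $\|n_i^c\|<\rho$ for $1\le i\le k-1$, one has $G[Z(\varepsilon,n^c,n_{k+1})]=0$ if and only if $n^c=\nu(\varepsilon,n_{k+1})$. -/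

import Mathlib

open Filter Topology Asymptotics

namespace JordanCone

noncomputable section

variable {𝕜 : Type*} [RCLike 𝕜]
  {B : Type*} [NormedAddCommGroup B] [NormedSpace 𝕜 B]
  {B' : Type*} [NormedAddCommGroup B'] [NormedSpace 𝕜 B']

/-- The linearization `L(ε) = G'[z(ε)]` of `G` along the curve `z`. -/
def linearization (G : B → B') (z : 𝕜 → B) (ε : 𝕜) : B →L[𝕜] B' :=
  fderiv 𝕜 G (z ε)

/-- The directional curvature `𝓑(ε) = ½ G''[z(ε)]` of `G` along the curve `z`. -/
def curvature (G : B → B') (z : 𝕜 → B) (ε : 𝕜) : B →L[𝕜] B →L[𝕜] B' :=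
  (1 / 2 : 𝕜) • fderiv 𝕜 (fderiv 𝕜 G) (z ε)

/-- `y` is a leading coefficient of order `i` of the family `L`: there is a curve
`b(ε) = b₀ + ε b₁ + ⋯ + εⁱ bᵢ` with `L(ε) b(ε) = εⁱ y + O(εⁱ⁺¹)`. -/
def IsLeadingCoeff (L : 𝕜 → B →L[𝕜] B') (i : ℕ) (y : B') : Prop :=
  ∃ b : ℕ → B, (fun ε : 𝕜 => L ε (∑ j ∈ Finset.range (i + 1), ε ^ j • b j) - ε ^ i • y)
    =O[𝓝 0] fun ε : 𝕜 => ε ^ (i + 1)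

/-- The family `L` is `k`-surjective: every element is a leading coefficient of order `k`. -/
def IsKSurjective (L : 𝕜 → B →L[𝕜] B') (k : ℕ) : Prop :=
  ∀ y : B', IsLeadingCoeff L k y

/-- The rank of `b₀` is at least `i`: there is a curve `b(ε) = b₀ + ε b₁ + ⋯ + εⁱ⁻¹ bᵢ₋₁`
starting at `b₀` with `L(ε) b(ε) = O(εⁱ)`, i.e. a Jordan chain of length `i` with root `b₀`. -/
def RankGE (L : 𝕜 → B →L[𝕜] B') (i : ℕ) (b₀ : B) : Prop :=
  ∃ b : ℕ → B, b 0 = b₀ ∧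
    (fun ε : 𝕜 => L ε (∑ j ∈ Finset.range i, ε ^ j • b j)) =O[𝓝 0] fun ε : 𝕜 => ε ^ i

/-- The projection to the summand `R i` along the other summands of an internal direct sum. -/
def directProj {ι : Type*} [DecidableEq ι] (R : ι → Submodule 𝕜 B')
    (h : DirectSum.IsInternal R) (i : ι) : B' →ₗ[𝕜] R i :=
  DirectSum.component 𝕜 ι (fun i => R i) i ∘ₗ
    (LinearEquiv.ofBijective (DirectSum.coeLinearMap R) h).symm.toLinearMap

/-- Direct sums `B = N₁ᶜ ⊕ ⋯ ⊕ Nₖ₊₁ᶜ ⊕ Nₖ₊₁` and `B' = R₁ ⊕ ⋯ ⊕ Rₖ₊₁` into closed subspaces,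
built up from the Jordan chains of increasing rank of the family `L`.
Indices start at `0`: `Nc i` and `R i` stand for `Nᵢ₊₁ᶜ` and `Rᵢ₊₁`, and belong to rank `i`. -/
structure JordanSplitting (L : 𝕜 → B →L[𝕜] B') (k : ℕ) where
  /-- the subspaces of `B` of rank `0, …, k` -/
  Nc : Fin (k + 1) → Submodule 𝕜 B
  /-- the remaining subspace of `B`, of rank at least `k + 1` -/
  N : Submodule 𝕜 B
  /-- the subspaces of `B'` -/
  R : Fin (k + 1) → Submodule 𝕜 B'
  isClosed_Nc : ∀ i, IsClosed (Nc i : Set B)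
  isClosed_N : IsClosed (N : Set B)
  isClosed_R : ∀ i, IsClosed (R i : Set B')
  isInternal_domain : DirectSum.IsInternal fun o : Option (Fin (k + 1)) => o.elim N Nc
  isInternal_R : DirectSum.IsInternal R
  /-- `Nᵢ₊₁ᶜ ⊕ ⋯ ⊕ Nₖ₊₁ᶜ ⊕ Nₖ₊₁` is the space of the elements of rank at least `i` -/
  rank_iff : ∀ i : ℕ, i ≤ k + 1 → ∀ b : B,
    b ∈ (⨆ (j : Fin (k + 1)) (_ : i ≤ (j : ℕ)), Nc j) ⊔ N ↔ RankGE L i b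
  /-- `R₁ ⊕ ⋯ ⊕ Rᵢ₊₁` is the space of the leading coefficients of order `i` -/
  leadingCoeff_iff : ∀ i : ℕ, i ≤ k → ∀ y : B',
    y ∈ (⨆ (j : Fin (k + 1)) (_ : (j : ℕ) ≤ i), R j) ↔ IsLeadingCoeff L i y

/-- The isomorphisms `S₁, …, Sₖ₊₁` and the polynomial near-identity family
`pₖ(ε) = I + ε φ₁ + ⋯ + εᵏ φₖ` attached to a splitting. -/
structure ChainFamily {L : 𝕜 → B →L[𝕜] B'} {k : ℕ} (D : JordanSplitting L k) where
  /-- `S i` stands for `Sᵢ₊₁ ∈ GL[Nᵢ₊₁ᶜ, Rᵢ₊₁]` -/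
  S : ∀ i : Fin (k + 1), D.Nc i ≃L[𝕜] D.R i
  /-- the coefficients; only those of index at most `k` are used -/
  φ : ℕ → B →L[𝕜] B
  φ_zero : φ 0 = ContinuousLinearMap.id 𝕜 B
  /-- `φᵢ` has values in `N₁ᶜ ⊕ ⋯ ⊕ Nₖ₊₁₋ᵢᶜ` -/
  φ_mem : ∀ i : ℕ, 1 ≤ i → i ≤ k → ∀ b : B,
    φ i b ∈ ⨆ (j : Fin (k + 1)) (_ : (j : ℕ) < k + 1 - i), D.Nc j
  /-- `L(ε) pₖ(ε) nᵢ₊₁ᶜ = εⁱ Sᵢ₊₁ nᵢ₊₁ᶜ + O(εⁱ⁺¹)` -/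
  chain_Nc : ∀ (i : Fin (k + 1)) (n : D.Nc i),
    (fun ε : 𝕜 => L ε ((∑ j ∈ Finset.range (k + 1), ε ^ j • φ j) (n : B))
      - ε ^ (i : ℕ) • (S i n : B')) =O[𝓝 0] fun ε : 𝕜 => ε ^ ((i : ℕ) + 1)
  /-- `L(ε) pₖ(ε) nₖ₊₁ = O(εᵏ⁺¹)` -/
  chain_N : ∀ m : D.N,
    (fun ε : 𝕜 => L ε ((∑ j ∈ Finset.range (k + 1), ε ^ j • φ j) (m : B)))
      =O[𝓝 0] fun ε : 𝕜 => ε ^ (k + 1)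

namespace ChainFamily

variable {L : 𝕜 → B →L[𝕜] B'} {k : ℕ} {D : JordanSplitting L k}

/-- The polynomial family `pₖ(ε) = I + ε φ₁ + ⋯ + εᵏ φₖ`. -/
def p (C : ChainFamily D) (ε : 𝕜) : B →L[𝕜] B :=
  ∑ j ∈ Finset.range (k + 1), ε ^ j • C.φ j

/-- The point
`z(ε) + εᵏ⁻¹ pₖ(ε) {εᵏ n₁ᶜ + ⋯ + ε nₖᶜ + nₖ₊₁ᶜ + nₖ₊₁}` of the cone around the curve `z`
whose Jordan chains start at `εᵏ⁻¹`. -/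
def conePoint (C : ChainFamily D) (z : 𝕜 → B) (ε : 𝕜) (n : ∀ i, D.Nc i) (m : D.N) : B :=
  z ε + ε ^ (k - 1) •
    C.p ε ((∑ i : Fin (k + 1), ε ^ (k - (i : ℕ)) • (n i : B)) + (m : B))

/-- `M` bounds the projections to `Rₖ`, `Rₖ₊₁`, the inverses of `Sₖ`, `Sₖ₊₁`, the operator `φ₁`
and the bilinear maps `𝓑₀`, `𝓑₁`. -/
structure BoundedBy (C : ChainFamily D) (𝓑₀ 𝓑₁ : B →L[𝕜] B →L[𝕜] B') (M : ℝ) : Prop where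
  proj : ∀ i : Fin (k + 1), k ≤ (i : ℕ) + 1 → ∀ y : B',
    ‖directProj D.R D.isInternal_R i y‖ ≤ M * ‖y‖
  S_symm : ∀ i : Fin (k + 1), k ≤ (i : ℕ) + 1 → ∀ y : D.R i, ‖(C.S i).symm y‖ ≤ M * ‖y‖
  φ_one : ‖C.φ 1‖ ≤ M
  curv_zero : ‖𝓑₀‖ ≤ M
  curv_one : ‖𝓑₁‖ ≤ M

end ChainFamily

end

end JordanCone

open JordanCone

/-! The theorem is a blow-up followed by a contraction argument. In the cone the increment is h =
ε^(k-1) (u + ε w(ε)) v, where v = (x, m) collects all components, u v is the sum of the last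
component of x and m, and w carries the rest. Each term of the Taylor expansion of G at z(ε) is then
divisible by ε^(2k-1). The value G[z(ε)] is so by assumption. In the linear term, L(ε) pₖ(ε) is of
order ε^i on the chains of rank i, whose components carry the weight ε^(k-i), so L contributes ε^k,
which with the prefactor gives ε^(2k-1). The quadratic term has only the factor ε^(2k-2), but its
leading part is killed by the curvature condition. The cubic term has the factor ε^(3k-3), which is
of higher order because k ≥ 3.

After division there remains a regular equation F(ε, x, m) = 0 with F(0, x, m) = S x + b̄(0) + Q.
Here S is the diagonal isomorphism built from the Sᵢ, and the quadratic part Q depends only on m and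
the two components of x of highest index. These two components solve a closed system, which is a
contraction on a ball of radius r depending on M alone. The remaining components are determined by
them without any smallness, so the system is triangular and becomes a contraction after rescaling
the lower components. This persists for small ε, uniformly on every ball. The implicit function
theorem gives smoothness in (ε, m), and the same contraction estimate on larger balls gives
uniqueness there. The reduction is `ChainFamily.exists_reduced_equation`; the solution is
`exists_solution_of_triangular`.

Jordan chains are built by induction on the rank (`ChainStage.succ`). The coefficient of order i of
a chain starting in rank at least i is a leading coefficient; its components in the earlier R j are
removed by subtracting chains of lower rank multiplied by powers of ε, and what is left is an
isomorphism of `Nc i` onto `R i`.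

Two analytic points recur. Quotients by powers of ε must be smooth, which costs one derivative per
power and accounts for the smoothness q + 2k. Bounded sets need not be compact, so convergence as ε
→ 0 is controlled in a bounded Lipschitz norm (`Tame`) instead of being deduced from continuity. -/

namespace JordanCone

/-! ### Smooth dependence of integrals over [0, 1] on a Banach space parameter -/

section ParametricIntegral

variable {𝕜 : Type*} [RCLike 𝕜]
  {Y : Type*} [NormedAddCommGroup Y] [NormedSpace 𝕜 Y]
  {Z : Type*} [NormedAddCommGroup Z] [NormedSpace 𝕜 Z]
  {F : Type*} [NormedAddCommGroup F] [NormedSpace 𝕜 F] [NormedSpace ℝ F]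

/-- Compactness of [0, 1] (the tube lemma) makes the bound uniform in `t` near `y₀`, although the
parameter space need not be locally compact. It supplies the dominating constants for passing to the
limit and differentiating under the integral. -/
theorem eventually_forall_norm_le_of_continuousOn {E : Type*} [SeminormedAddCommGroup E]
    {P : ℝ → Y → E} {Ω : Set Y} (hΩ : IsOpen Ω)
    (hP : ContinuousOn (fun x : ℝ × Y => P x.1 x.2) (Set.univ ×ˢ Ω)) {y₀ : Y} (hy : y₀ ∈ Ω) :
    ∃ C : ℝ, ∀ᶠ y in 𝓝 y₀, ∀ t ∈ Set.Icc (0 : ℝ) 1, ‖P t y‖ ≤ C := by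
  have hat : ∀ t : ℝ, ContinuousAt (fun x : ℝ × Y => P x.1 x.2) (t, y₀) := fun t =>
    hP.continuousAt ((isOpen_univ.prod hΩ).mem_nhds ⟨trivial, hy⟩)
  have hc : Continuous fun t => P t y₀ := by
    rw [continuous_iff_continuousAt]
    intro t
    exact ContinuousAt.comp (f := fun t : ℝ => (t, y₀)) (hat t) (by fun_prop)
  obtain ⟨C, hC⟩ := (isCompact_Icc (a := (0 : ℝ)) (b := 1)).exists_bound_of_continuousOn
    hc.continuousOn
  refine ⟨C + 1, ?_⟩
  refine isCompact_Icc.eventually_forall_of_forall_eventually fun t ht => ?_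
  have h1 : ContinuousAt (fun x : Y × ℝ => ‖P x.2 x.1‖) (y₀, t) :=
    (ContinuousAt.comp (f := fun x : Y × ℝ => (x.2, x.1)) (x := (y₀, t)) (hat t)
      (by fun_prop)).norm
  have h2 : ‖P t y₀‖ < C + 1 := (hC t ht).trans_lt (by linarith)
  exact (h1.eventually_lt_const h2).mono fun _ h => h.le

theorem continuousOn_integral_of_continuousOn
    {P : ℝ → Y → F} {Ω : Set Y} (hΩ : IsOpen Ω)
    (hP : ContinuousOn (fun x : ℝ × Y => P x.1 x.2) (Set.univ ×ˢ Ω)) :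
    ContinuousOn (fun y => ∫ t in (0 : ℝ)..1, P t y) Ω := by
  intro y₀ hy
  refine ContinuousAt.continuousWithinAt ?_
  obtain ⟨C, hC⟩ := eventually_forall_norm_le_of_continuousOn hΩ hP hy
  have hc : ∀ y ∈ Ω, Continuous fun t => P t y := fun y hy =>
    hP.comp_continuous (f := fun t : ℝ => (t, y)) (by fun_prop) fun t => ⟨trivial, hy⟩
  refine intervalIntegral.continuousAt_of_dominated_interval (bound := fun _ => C) ?_ ?_ ?_ ?_
  · filter_upwards [hΩ.mem_nhds hy] with y hy'
    exact (hc y hy').aestronglyMeasurable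
  · filter_upwards [hC] with y hy'
    refine Eventually.of_forall fun t ht => hy' t ?_
    rw [Set.uIoc_of_le zero_le_one] at ht
    exact Set.Ioc_subset_Icc_self ht
  · simp
  · refine Eventually.of_forall fun t _ => ?_
    have hat := hP.continuousAt (x := (t, y₀)) ((isOpen_univ.prod hΩ).mem_nhds ⟨trivial, hy⟩)
    exact ContinuousAt.comp (f := fun y : Y => (t, y)) hat (by fun_prop)

theorem hasFDerivAt_integral_of_continuousOn {P : ℝ → Y → F} {P' : ℝ → Y → Y →L[𝕜] F}
    [SMulCommClass 𝕜 ℝ F]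
    {Ω : Set Y} (hΩ : IsOpen Ω)
    (hP : ContinuousOn (fun x : ℝ × Y => P x.1 x.2) (Set.univ ×ˢ Ω))
    (hP' : ContinuousOn (fun x : ℝ × Y => P' x.1 x.2) (Set.univ ×ˢ Ω))
    (hd : ∀ t, ∀ y ∈ Ω, HasFDerivAt (P t) (P' t y) y) {y₀ : Y} (hy : y₀ ∈ Ω) :
    HasFDerivAt (fun y => ∫ t in (0 : ℝ)..1, P t y) (∫ t in (0 : ℝ)..1, P' t y₀) y₀ := by
  obtain ⟨C, hC⟩ := eventually_forall_norm_le_of_continuousOn hΩ hP' hy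
  have hc : ∀ y ∈ Ω, Continuous fun t => P t y := fun y hy =>
    hP.comp_continuous (f := fun t : ℝ => (t, y)) (by fun_prop) fun t => ⟨trivial, hy⟩
  have hc' : ∀ y ∈ Ω, Continuous fun t => P' t y := fun y hy =>
    hP'.comp_continuous (f := fun t : ℝ => (t, y)) (by fun_prop) fun t => ⟨trivial, hy⟩
  refine intervalIntegral.hasFDerivAt_integral_of_dominated_of_fderiv_le
    (bound := fun _ => C) (F := fun y t => P t y) (F' := fun y t => P' t y)
    (inter_mem hC (hΩ.mem_nhds hy)) ?_ ?_ ?_ ?_ ?_ ?_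
  · filter_upwards [hΩ.mem_nhds hy] with y hy'
    exact (hc y hy').aestronglyMeasurable
  · exact (hc y₀ hy).intervalIntegrable _ _
  · exact (hc' y₀ hy).aestronglyMeasurable
  · refine Eventually.of_forall fun t ht y hy' => hy'.1 t ?_
    rw [Set.uIoc_of_le zero_le_one] at ht
    exact Set.Ioc_subset_Icc_self ht
  · simp
  · exact Eventually.of_forall fun t _ y hy' => hd t y hy'.2

/-- The Taylor series of the integral is the integral of the Taylor series of the integrands, so all
orders are handled at once, including n = ∞. -/
theorem contDiffOn_integral_comp_of_forall [IsScalarTower ℝ 𝕜 F] [CompleteSpace F]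
    (n : ℕ∞) {f : Z → F} {O : Set Z}
    (hO : IsOpen O) (hf : ContDiffOn 𝕜 n f O) {Ω : Set Y} (hΩ : IsOpen Ω) {w : ℝ → ℝ}
    (hw : Continuous w) {σ : ℝ → Y →L[𝕜] Z} (hσ : Continuous σ)
    (h : ∀ t, ∀ y ∈ Ω, σ t y ∈ O) :
    ContDiffOn 𝕜 n (fun y => ∫ t in (0 : ℝ)..1, w t • f (σ t y)) Ω := by
  have hT := hf.ftaylorSeriesWithin hO.uniqueDiffOn
  set p := ftaylorSeriesWithin 𝕜 f O
  let P : ∀ m : ℕ, ℝ → Y → Y[×m]→L[𝕜] F := fun m t y =>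
    w t • (p (σ t y) m).compContinuousLinearMap fun _ => σ t
  have hσc : Continuous fun x : ℝ × Y => σ x.1 x.2 := by fun_prop
  have hPc : ∀ m : ℕ, (m : WithTop ℕ∞) ≤ n →
      ContinuousOn (fun x : ℝ × Y => P m x.1 x.2) (Set.univ ×ˢ Ω) := by
    intro m hm
    have h1 : ContinuousOn (fun x : ℝ × Y => p (σ x.1 x.2) m) (Set.univ ×ˢ Ω) :=
      (hT.cont m hm).comp hσc.continuousOn fun x hx => h _ _ hx.2
    have h2 : Continuous fun x : ℝ × Y =>
        ContinuousMultilinearMap.compContinuousLinearMapContinuousMultilinear 𝕜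
          (fun _ : Fin m => Y) (fun _ : Fin m => Z) F (fun _ => σ x.1) := by
      refine (ContinuousMultilinearMap.cont _).comp ?_
      fun_prop
    exact (hw.comp continuous_fst).continuousOn.smul (h2.continuousOn.clm_apply h1)
  have hPd : ∀ m : ℕ, (m : WithTop ℕ∞) < n → ∀ t, ∀ y ∈ Ω,
      HasFDerivAt (P m t) (P (m + 1) t y).curryLeft y := by
    intro m hm t y hy
    have h1 := (hT.compContinuousLinearMap (σ t)).fderivWithin m hm y (h t y hy)
    have h2 := h1.hasFDerivAt ((hO.preimage (σ t).continuous).mem_nhds (h t y hy))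
    exact h2.const_smul (w t)
  have key : HasFTaylorSeriesUpToOn (n : WithTop ℕ∞)
      (fun y => ∫ t in (0 : ℝ)..1, w t • f (σ t y))
      (fun y m => ∫ t in (0 : ℝ)..1, P m t y) Ω := by
    refine ⟨fun y hy => ?_, fun m hm y hy => ?_, fun m hm => ?_⟩
    · have hc : Continuous fun t => P 0 t y :=
        (hPc 0 (by simp)).comp_continuous (f := fun t : ℝ => (t, y)) (by fun_prop)
          fun t => ⟨trivial, hy⟩
      have := ContinuousLinearMap.intervalIntegral_comp_comm
        (((continuousMultilinearCurryFin0 𝕜 Y F).toContinuousLinearEquiv :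
          (Y[×0]→L[𝕜] F) →L[𝕜] F)) (hc.intervalIntegrable (μ := MeasureTheory.volume) 0 1)
      refine this.symm.trans ?_
      refine intervalIntegral.integral_congr fun t _ => ?_
      have := hT.zero_eq _ (h t y hy)
      simp only [← this]
      rfl
    · have hm' : ((m + 1 : ℕ) : WithTop ℕ∞) ≤ n := by
        have h1 : (m : ℕ∞) < n := by exact_mod_cast hm
        have h2 : ((m + 1 : ℕ) : ℕ∞) ≤ n := by
          rw [Nat.cast_add_one]
          exact Order.add_one_le_of_lt h1
        exact_mod_cast h2
      have hcl : ContinuousOn (fun x : ℝ × Y => (P (m + 1) x.1 x.2).curryLeft)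
          (Set.univ ×ˢ Ω) :=
        (continuousMultilinearCurryLeftEquiv 𝕜 (fun _ : Fin (m + 1) => Y) F).continuous.comp_continuousOn
          (hPc (m + 1) hm')
      have := hasFDerivAt_integral_of_continuousOn hΩ (hPc m hm.le) hcl
        (fun t y hy => hPd m hm t y hy) hy
      have hc : Continuous fun t => P (m + 1) t y :=
        (hPc _ hm').comp_continuous (f := fun t : ℝ => (t, y)) (by fun_prop)
          fun t => ⟨trivial, hy⟩
      let curry : (Y[×m+1]→L[𝕜] F) →L[𝕜] (Y →L[𝕜] Y[×m]→L[𝕜] F) :=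
        (continuousMultilinearCurryLeftEquiv 𝕜
          (fun _ : Fin (m + 1) => Y) F).toContinuousLinearEquiv.toContinuousLinearMap
      have e := ContinuousLinearMap.intervalIntegral_comp_comm (𝕜 := 𝕜)
        (E := Y[×m+1]→L[𝕜] F) (F := Y →L[𝕜] Y[×m]→L[𝕜] F) curry
          (hc.intervalIntegrable (μ := MeasureTheory.volume) 0 1)
      refine (this.congr_fderiv ?_).hasFDerivWithinAt
      exact e
    · exact continuousOn_integral_of_continuousOn hΩ (hPc m hm)
  exact key.contDiffOn

/-- Integrals of `f` along a continuous family of linear substitutions are as smooth as `f`. -/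
theorem contDiffOn_integral_comp [IsScalarTower ℝ 𝕜 F] [CompleteSpace F]
    (n : ℕ∞) {f : Z → F} {O : Set Z}
    (hO : IsOpen O) (hf : ContDiffOn 𝕜 n f O) {Ω : Set Y} (hΩ : IsOpen Ω) {w : ℝ → ℝ}
    (hw : Continuous w) {σ : ℝ → Y →L[𝕜] Z} (hσ : Continuous σ)
    (h : ∀ t ∈ Set.Icc (0 : ℝ) 1, ∀ y ∈ Ω, σ t y ∈ O) :
    ContDiffOn 𝕜 n (fun y => ∫ t in (0 : ℝ)..1, w t • f (σ t y)) Ω := by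
  -- Clamping `t` to [0, 1] leaves the integral unchanged and makes the domain condition hold for
  -- every real `t`.
  have hp : Continuous fun t : ℝ => (Set.projIcc (0 : ℝ) 1 zero_le_one t : ℝ) := by fun_prop
  refine (contDiffOn_integral_comp_of_forall n hO hf hΩ hw (hσ.comp hp)
    fun t y hy => h _ (Subtype.prop _) y hy).congr fun y _ => ?_
  refine intervalIntegral.integral_congr fun t ht => ?_
  rw [Set.uIcc_of_le zero_le_one] at ht
  simp [Set.projIcc_of_mem zero_le_one ht]

end ParametricIntegral
end JordanCone

set_option maxSynthPendingDepth 3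
set_option linter.unusedSectionVars false

namespace JordanCone

/-! ### Taylor expansions with smooth remainders and division by powers of ε -/

section Taylor

variable {𝕜 : Type*} [RCLike 𝕜]
  {E : Type*} [NormedAddCommGroup E] [NormedSpace 𝕜 E]
  {F : Type*} [NormedAddCommGroup F] [NormedSpace 𝕜 F]

theorem hasDerivAt_ofReal (t : ℝ) : HasDerivAt (fun t : ℝ => (t : 𝕜)) 1 t := by
  simpa using (RCLike.ofRealCLM (K := 𝕜)).hasDerivAt (x := t)

section Real

variable [NormedSpace ℝ F] [IsScalarTower ℝ 𝕜 F]

theorem hasDerivAt_comp_add_ofReal_smul {f : E → F} (a h : E) (t : ℝ)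
    (hf : DifferentiableAt 𝕜 f (a + (t : 𝕜) • h)) :
    HasDerivAt (fun t : ℝ => f (a + (t : 𝕜) • h)) (fderiv 𝕜 f (a + (t : 𝕜) • h) h) t := by
  have h1 : HasDerivAt (fun s : 𝕜 => a + s • h) h (t : 𝕜) := by
    simpa using ((hasDerivAt_id (t : 𝕜)).smul_const h).const_add a
  have h2 := hf.hasFDerivAt.comp_hasDerivAt (t : 𝕜) h1
  simpa [Function.comp_def] using
    HasDerivAt.scomp (h := fun t : ℝ => (t : 𝕜)) t h2 (hasDerivAt_ofReal t)

theorem exists_taylor_remainder_aux [CompleteSpace F] (n : ℕ∞) {f : E → F}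
    (hf : ContDiff 𝕜 ((n + 3 : ℕ∞) : WithTop ℕ∞) f) :
    ∃ K : E × E → E →L[𝕜] E →L[𝕜] E →L[𝕜] F, ContDiff 𝕜 n K ∧
      ∀ a h, f (a + h) = f a + fderiv 𝕜 f a h + (1 / 2 : 𝕜) • fderiv 𝕜 (fderiv 𝕜 f) a h h
        + K (a, h) h h h := by
  have _ : CompleteSpace (E →L[𝕜] F) := inferInstance
  have _ : CompleteSpace (E →L[𝕜] E →L[𝕜] F) := inferInstance
  have _ : CompleteSpace (E →L[𝕜] E →L[𝕜] E →L[𝕜] F) := inferInstance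
  have hf1 : ContDiff 𝕜 ((n + 2 : ℕ∞) : WithTop ℕ∞) (fderiv 𝕜 f) :=
    hf.fderiv_right (by rw [show n + 3 = n + 2 + 1 by rw [add_assoc]; norm_num]; norm_cast)
  have hf2 : ContDiff 𝕜 ((n + 1 : ℕ∞) : WithTop ℕ∞) (fderiv 𝕜 (fderiv 𝕜 f)) :=
    hf1.fderiv_right (by rw [show n + 2 = n + 1 + 1 by rw [add_assoc]; norm_num]; norm_cast)
  have hf3 : ContDiff 𝕜 (n : WithTop ℕ∞) (fderiv 𝕜 (fderiv 𝕜 (fderiv 𝕜 f))) :=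
    hf2.fderiv_right (by norm_cast)
  have d0 : Differentiable 𝕜 f := hf.differentiable (by simp)
  have d1 : Differentiable 𝕜 (fderiv 𝕜 f) := hf1.differentiable (by simp)
  have d2 : Differentiable 𝕜 (fderiv 𝕜 (fderiv 𝕜 f)) := hf2.differentiable (by simp)
  let σ : ℝ → E × E →L[𝕜] E := fun t =>
    ContinuousLinearMap.fst 𝕜 E E + (t : 𝕜) • ContinuousLinearMap.snd 𝕜 E E
  have hσ : Continuous σ :=
    continuous_const.add
      ((RCLike.continuous_ofReal (K := 𝕜)).smul (continuous_const (y := ContinuousLinearMap.snd 𝕜 E E)))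
  let w : ℝ → ℝ := fun t => (1 - t) ^ 2 / 2
  have hw : Continuous w := by fun_prop
  let K : E × E → E →L[𝕜] E →L[𝕜] E →L[𝕜] F := fun y =>
    ∫ t in (0 : ℝ)..1, w t • fderiv 𝕜 (fderiv 𝕜 (fderiv 𝕜 f)) (σ t y)
  refine ⟨K, ?_, fun a h => ?_⟩
  · rw [← contDiffOn_univ]
    exact contDiffOn_integral_comp n isOpen_univ hf3.contDiffOn isOpen_univ hw hσ (by simp)
  let f3 : ℝ → E →L[𝕜] E →L[𝕜] E →L[𝕜] F := fun t =>
    w t • fderiv 𝕜 (fderiv 𝕜 (fderiv 𝕜 f)) (σ t (a, h))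
  have hc3 : Continuous f3 := hw.smul (hf3.continuous.comp (by fun_prop))
  let ev : (E →L[𝕜] E →L[𝕜] E →L[𝕜] F) →L[𝕜] F :=
    (ContinuousLinearMap.apply 𝕜 F h).comp ((ContinuousLinearMap.apply 𝕜 (E →L[𝕜] F) h).comp
      (ContinuousLinearMap.apply 𝕜 (E →L[𝕜] E →L[𝕜] F) h))
  have hev : ∀ T, ev T = T h h h := fun T => rfl
  have hK : K (a, h) h h h = ∫ t in (0 : ℝ)..1, ev (f3 t) := by
    rw [ContinuousLinearMap.intervalIntegral_comp_comm ev (hc3.intervalIntegrable 0 1), hev]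
  -- `Φ 1` is f(a + h) and `Φ 0` is the second order Taylor polynomial; in the derivative everything
  -- but the third order term cancels.
  let Φ : ℝ → F := fun t => f (a + (t : 𝕜) • h) + (1 - t) • fderiv 𝕜 f (a + (t : 𝕜) • h) h
    + w t • fderiv 𝕜 (fderiv 𝕜 f) (a + (t : 𝕜) • h) h h
  have hΦ : ∀ t, HasDerivAt Φ (ev (f3 t)) t := by
    intro t
    have e0 := hasDerivAt_comp_add_ofReal_smul a h t (d0 _)
    have e1 := hasDerivAt_comp_add_ofReal_smul (f := fun x => fderiv 𝕜 f x h) a h t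
      ((d1 _).clm_apply (differentiableAt_const h))
    have e2 := hasDerivAt_comp_add_ofReal_smul (f := fun x => fderiv 𝕜 (fderiv 𝕜 f) x h h) a h t
      (((d2 _).clm_apply (differentiableAt_const h)).clm_apply (differentiableAt_const h))
    have i1 : fderiv 𝕜 (fun x => fderiv 𝕜 f x h) (a + (t : 𝕜) • h) h
        = fderiv 𝕜 (fderiv 𝕜 f) (a + (t : 𝕜) • h) h h := by
      rw [((d1 _).hasFDerivAt.clm_apply (hasFDerivAt_const h _)).fderiv]; simp
    have i2 : fderiv 𝕜 (fun x => fderiv 𝕜 (fderiv 𝕜 f) x h h) (a + (t : 𝕜) • h) h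
        = fderiv 𝕜 (fderiv 𝕜 (fderiv 𝕜 f)) (a + (t : 𝕜) • h) h h h := by
      rw [(((d2 _).hasFDerivAt.clm_apply (hasFDerivAt_const h _)).clm_apply
        (hasFDerivAt_const h _)).fderiv]; simp
    rw [i1] at e1
    rw [i2] at e2
    have s1 : HasDerivAt (fun t : ℝ => 1 - t) (-1) t := by
      simpa using (hasDerivAt_id t).const_sub 1
    have s2 : HasDerivAt w (-(1 - t)) t := by
      refine ((s1.pow 2).div_const 2).congr_deriv ?_
      simp; ring
    refine ((e0.add (s1.smul e1)).add (s2.smul e2)).congr_deriv ?_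
    have : ev (f3 t) = w t • fderiv 𝕜 (fderiv 𝕜 (fderiv 𝕜 f)) (a + (t : 𝕜) • h) h h h := by
      rw [hev]; simp [f3, σ]
    rw [this]
    module
  have hint := intervalIntegral.integral_eq_sub_of_hasDerivAt (fun t _ => hΦ t)
    ((ev.continuous.comp hc3).intervalIntegrable 0 1)
  rw [hK, hint]
  have half : ((1 / 2 : ℝ)) • fderiv 𝕜 (fderiv 𝕜 f) a h h
      = (1 / 2 : 𝕜) • fderiv 𝕜 (fderiv 𝕜 f) a h h := by
    rw [← algebraMap_smul 𝕜 (1 / 2 : ℝ), map_div₀, map_one, map_ofNat]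
  simp only [Φ, w]
  simp only [RCLike.ofReal_one, one_smul, sub_self, zero_smul, RCLike.ofReal_zero, add_zero,
    sub_zero, one_pow, half]
  norm_num

/-- Hadamard's lemma: the quotient is the mean of f' over the segment from 0 to ε, which costs
exactly one derivative. -/
theorem exists_eq_add_smul_aux [CompleteSpace F] (n : ℕ∞) {f : 𝕜 → F} {ρ : ℝ}
    (hf : ContDiffOn 𝕜 ((n + 1 : ℕ∞) : WithTop ℕ∞) f (Metric.ball 0 ρ)) :
    ∃ g : 𝕜 → F, ContDiffOn 𝕜 n g (Metric.ball 0 ρ) ∧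
      ∀ ε ∈ Metric.ball (0 : 𝕜) ρ, f ε = f 0 + ε • g ε := by
  have hd : ContDiffOn 𝕜 n (deriv f) (Metric.ball 0 ρ) :=
    hf.deriv_of_isOpen Metric.isOpen_ball (by norm_cast)
  let σ : ℝ → 𝕜 →L[𝕜] 𝕜 := fun t => (t : 𝕜) • ContinuousLinearMap.id 𝕜 𝕜
  have hσ : Continuous σ := (RCLike.continuous_ofReal (K := 𝕜)).smul
    (continuous_const (y := ContinuousLinearMap.id 𝕜 𝕜))
  have hball : ∀ t ∈ Set.Icc (0 : ℝ) 1, ∀ y ∈ Metric.ball (0 : 𝕜) ρ,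
      σ t y ∈ Metric.ball (0 : 𝕜) ρ := by
    intro t ht y hy
    simp only [mem_ball_zero_iff] at hy ⊢
    simp only [σ, smul_apply, ContinuousLinearMap.id_apply, norm_smul,
      RCLike.norm_ofReal, abs_of_nonneg ht.1]
    exact (mul_le_of_le_one_left (norm_nonneg y) ht.2).trans_lt hy
  refine ⟨fun ε => ∫ t in (0 : ℝ)..1, (1 : ℝ) • deriv f (σ t ε),
    contDiffOn_integral_comp n Metric.isOpen_ball hd Metric.isOpen_ball continuous_const hσ hball,
    fun ε hε => ?_⟩
  have hder : ∀ t ∈ Set.uIcc (0 : ℝ) 1, HasDerivAt (fun t : ℝ => f (0 + (t : 𝕜) • ε))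
      (ε • deriv f (σ t ε)) t := by
    intro t ht
    rw [Set.uIcc_of_le zero_le_one] at ht
    have hm := hball t ht ε hε
    have hda : DifferentiableAt 𝕜 f (0 + (t : 𝕜) • ε) := by
      rw [zero_add]
      exact (hf.differentiableOn (by simp)).differentiableAt (Metric.isOpen_ball.mem_nhds hm)
    refine (hasDerivAt_comp_add_ofReal_smul (f := f) 0 ε t hda).congr_deriv ?_
    rw [zero_add, ← toSpanSingleton_deriv]
    simp [σ, RCLike.real_smul_eq_coe_mul]
  have hcont : ContinuousOn (fun t : ℝ => ε • deriv f (σ t ε)) (Set.uIcc 0 1) := by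
    rw [Set.uIcc_of_le zero_le_one]
    have : Continuous fun t : ℝ => σ t ε := by fun_prop
    exact (hd.continuousOn.comp this.continuousOn fun t ht => hball t ht ε hε).const_smul ε
  have hint := intervalIntegral.integral_eq_sub_of_hasDerivAt hder hcont.intervalIntegrable
  simp only [one_smul]
  rw [← intervalIntegral.integral_smul, hint]
  simp

end Real

/-- Taylor's formula of order two whose remainder is a smooth trilinear form. -/
theorem exists_taylor_remainder [CompleteSpace F] (n : ℕ∞) {f : E → F}
    (hf : ContDiff 𝕜 ((n + 3 : ℕ∞) : WithTop ℕ∞) f) :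
    ∃ K : E × E → E →L[𝕜] E →L[𝕜] E →L[𝕜] F, ContDiff 𝕜 n K ∧
      ∀ a h, f (a + h) = f a + fderiv 𝕜 f a h + (1 / 2 : 𝕜) • fderiv 𝕜 (fderiv 𝕜 f) a h h
        + K (a, h) h h h := by
  let _ : NormedSpace ℝ F := NormedSpace.restrictScalars ℝ 𝕜 F
  have _ : IsScalarTower ℝ 𝕜 F := RestrictScalars.isScalarTower ℝ 𝕜 F
  exact exists_taylor_remainder_aux n hf

theorem exists_eq_add_smul [CompleteSpace F] (n : ℕ∞) {f : 𝕜 → F} {ρ : ℝ}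
    (hf : ContDiffOn 𝕜 ((n + 1 : ℕ∞) : WithTop ℕ∞) f (Metric.ball 0 ρ)) :
    ∃ g : 𝕜 → F, ContDiffOn 𝕜 n g (Metric.ball 0 ρ) ∧
      ∀ ε ∈ Metric.ball (0 : 𝕜) ρ, f ε = f 0 + ε • g ε := by
  let _ : NormedSpace ℝ F := NormedSpace.restrictScalars ℝ 𝕜 F
  have _ : IsScalarTower ℝ 𝕜 F := RestrictScalars.isScalarTower ℝ 𝕜 F
  exact exists_eq_add_smul_aux n hf

/-- A function of one variable is a polynomial plus `ε ^ i` times a smooth function. -/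
theorem exists_expansion [CompleteSpace F] (n : ℕ∞) (i : ℕ) {f : 𝕜 → F} {ρ : ℝ}
    (hf : ContDiffOn 𝕜 ((n + i : ℕ∞) : WithTop ℕ∞) f (Metric.ball 0 ρ)) :
    ∃ (c : ℕ → F) (g : 𝕜 → F), ContDiffOn 𝕜 n g (Metric.ball 0 ρ) ∧
      ∀ ε ∈ Metric.ball (0 : 𝕜) ρ, f ε = (∑ j ∈ Finset.range i, ε ^ j • c j) + ε ^ i • g ε := by
  induction i generalizing f with
  | zero => exact ⟨0, f, by simpa using hf, by simp⟩
  | succ i ih =>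
    obtain ⟨g, hg, hfg⟩ := exists_eq_add_smul (n + i) (f := f) (by rw [add_assoc]; exact_mod_cast hf)
    obtain ⟨c, g', hg', hgg⟩ := ih hg
    refine ⟨fun j => Nat.casesOn j (f 0) c, g', hg', fun ε hε => ?_⟩
    rw [hfg ε hε, hgg ε hε, Finset.sum_range_succ']
    simp only [pow_succ', pow_zero, one_smul, smul_add, Finset.smul_sum, smul_smul]
    rw [add_comm, add_assoc, add_comm _ (f 0), ← add_assoc]
    rfl

theorem eq_zero_of_sum_pow_isBigO {i : ℕ} {c : ℕ → F}
    (h : (fun ε : 𝕜 => ∑ j ∈ Finset.range i, ε ^ j • c j) =O[𝓝[≠] 0] fun ε : 𝕜 => ε ^ i) :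
    ∀ j < i, c j = 0 := by
  induction i generalizing c with
  | zero => intro j hj; omega
  | succ i ih =>
    have h0 : c 0 = 0 := by
      have t1 : Tendsto (fun ε : 𝕜 => ∑ j ∈ Finset.range (i + 1), ε ^ j • c j) (𝓝[≠] 0)
          (𝓝 0) := by
        refine h.trans_tendsto (tendsto_nhdsWithin_of_tendsto_nhds ?_)
        have : Continuous fun ε : 𝕜 => ε ^ (i + 1) := by fun_prop
        simpa using this.tendsto 0
      have t2 : Tendsto (fun ε : 𝕜 => ∑ j ∈ Finset.range (i + 1), ε ^ j • c j) (𝓝[≠] 0)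
          (𝓝 (c 0)) := by
        refine tendsto_nhdsWithin_of_tendsto_nhds ?_
        have : Continuous fun ε : 𝕜 => ∑ j ∈ Finset.range (i + 1), ε ^ j • c j := by fun_prop
        simpa [Finset.sum_range_succ'] using this.tendsto 0
      exact tendsto_nhds_unique t2 t1
    have h1 : (fun ε : 𝕜 => ∑ j ∈ Finset.range i, ε ^ j • c (j + 1)) =O[𝓝[≠] 0]
        fun ε : 𝕜 => ε ^ i := by
      have h2 : (fun ε : 𝕜 => ε⁻¹) =O[𝓝[≠] 0] fun ε : 𝕜 => ε⁻¹ := isBigO_refl _ _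
      refine (h2.smul h).congr' ?_ ?_
      · filter_upwards [self_mem_nhdsWithin] with ε hε
        have hε : ε ≠ 0 := hε
        rw [Finset.sum_range_succ', h0, smul_zero, add_zero, Finset.smul_sum]
        refine Finset.sum_congr rfl fun j _ => ?_
        rw [smul_smul, pow_succ', inv_mul_cancel_left₀ hε]
      · filter_upwards [self_mem_nhdsWithin] with ε hε
        have hε : ε ≠ 0 := hε
        rw [smul_eq_mul, pow_succ', inv_mul_cancel_left₀ hε]
    intro j hj
    cases j with
    | zero => exact h0
    | succ j => exact ih h1 j (by omega)

/-- Asymptotic expansions are unique. This turns an order estimate into exact divisibility by a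
power of ε and identifies the quotient at 0. -/
theorem expansion_unique {i : ℕ} {f g : 𝕜 → F} {c : ℕ → F} {s : F} (hg : ContinuousAt g 0)
    (hf : ∀ᶠ ε in 𝓝 (0 : 𝕜), f ε = (∑ j ∈ Finset.range i, ε ^ j • c j) + ε ^ i • g ε)
    (h : (fun ε : 𝕜 => f ε - ε ^ i • s) =o[𝓝 0] fun ε : 𝕜 => ε ^ i) :
    (∀ j < i, c j = 0) ∧ g 0 = s := by
  have hpow : ∀ b : 𝕜 → F, ContinuousAt b 0 →
      (fun ε : 𝕜 => ε ^ i • b ε) =O[𝓝 0] fun ε : 𝕜 => ε ^ i := fun b hb => by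
    simpa using (isBigO_refl (fun ε : 𝕜 => ε ^ i) (𝓝 0)).smul (hb.isBigO_one 𝕜)
  have hc : ∀ j < i, c j = 0 := by
    refine eq_zero_of_sum_pow_isBigO (𝕜 := 𝕜) (IsBigO.mono ?_ nhdsWithin_le_nhds)
    refine ((h.isBigO.add (hpow _ (continuousAt_const (y := s)))).sub (hpow g hg)).congr' ?_
      EventuallyEq.rfl
    filter_upwards [hf] with ε hε
    rw [hε]
    abel
  refine ⟨hc, ?_⟩
  have h1 : (fun ε : 𝕜 => ε ^ i • (g ε - s)) =o[𝓝[≠] 0] fun ε : 𝕜 => ε ^ i := by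
    refine (h.mono nhdsWithin_le_nhds).congr' ?_ EventuallyEq.rfl
    filter_upwards [nhdsWithin_le_nhds hf] with ε hε
    rw [hε, Finset.sum_eq_zero fun j hj => by rw [hc j (Finset.mem_range.1 hj), smul_zero],
      zero_add, smul_sub]
  have h2 : (fun ε : 𝕜 => g ε - s) =o[𝓝[≠] 0] fun _ : 𝕜 => (1 : 𝕜) := by
    refine ((isBigO_refl (fun ε : 𝕜 => (ε ^ i)⁻¹) _).smul_isLittleO h1).congr' ?_ ?_
    · filter_upwards [self_mem_nhdsWithin] with ε hε
      have hε : ε ^ i ≠ 0 := pow_ne_zero _ hε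
      rw [smul_smul, inv_mul_cancel₀ hε, one_smul]
    · filter_upwards [self_mem_nhdsWithin] with ε hε
      have hε : ε ^ i ≠ 0 := pow_ne_zero _ hε
      rw [smul_eq_mul, inv_mul_cancel₀ hε]
  have h3 := (isLittleO_one_iff 𝕜).1 h2
  have h4 : Tendsto (fun ε => g ε - s) (𝓝[≠] 0) (𝓝 (g 0 - s)) :=
    tendsto_nhdsWithin_of_tendsto_nhds (hg.sub continuousAt_const).tendsto
  exact sub_eq_zero.1 (tendsto_nhds_unique h4 h3)

theorem continuousAt_zero_of_contDiffOn {n : WithTop ℕ∞} {f : 𝕜 → F} {ρ : ℝ} (hρ : 0 < ρ)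
    (hf : ContDiffOn 𝕜 n f (Metric.ball 0 ρ)) : ContinuousAt f 0 :=
  hf.continuousOn.continuousAt (Metric.ball_mem_nhds 0 hρ)

/-- Division of a smooth function by a power of the variable. -/
theorem exists_eq_pow_smul [CompleteSpace F] (n : ℕ∞) (i : ℕ) {f : 𝕜 → F} {ρ : ℝ} (hρ : 0 < ρ)
    (hf : ContDiffOn 𝕜 ((n + i : ℕ∞) : WithTop ℕ∞) f (Metric.ball 0 ρ)) {s : F}
    (h : (fun ε : 𝕜 => f ε - ε ^ i • s) =o[𝓝 0] fun ε : 𝕜 => ε ^ i) :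
    ∃ g : 𝕜 → F, ContDiffOn 𝕜 n g (Metric.ball 0 ρ) ∧
      (∀ ε ∈ Metric.ball (0 : 𝕜) ρ, f ε = ε ^ i • g ε) ∧ g 0 = s := by
  obtain ⟨c, g, hg, hfg⟩ := exists_expansion n i hf
  obtain ⟨hc, h0⟩ := expansion_unique (continuousAt_zero_of_contDiffOn hρ hg)
    (by filter_upwards [Metric.ball_mem_nhds (0 : 𝕜) hρ] with ε hε using hfg ε hε) h
  refine ⟨g, hg, fun ε hε => ?_, h0⟩
  rw [hfg ε hε, Finset.sum_eq_zero fun j hj => by rw [hc j (Finset.mem_range.1 hj), smul_zero],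
    zero_add]

/-- The estimate is assumed only pointwise in `x`, with constants depending on `x`. The expansion
itself holds in operator norm, and its coefficients can be identified pointwise, so divisibility
holds in operator norm. -/
theorem exists_eq_pow_smul_clm [CompleteSpace F] (n : ℕ∞) (i : ℕ) {f : 𝕜 → E →L[𝕜] F} {ρ : ℝ}
    (hρ : 0 < ρ) (hf : ContDiffOn 𝕜 ((n + i : ℕ∞) : WithTop ℕ∞) f (Metric.ball 0 ρ))
    {S : E →L[𝕜] F} (h : ∀ x, (fun ε : 𝕜 => f ε x - ε ^ i • S x) =O[𝓝 0] fun ε : 𝕜 => ε ^ (i + 1)) :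
    ∃ g : 𝕜 → E →L[𝕜] F, ContDiffOn 𝕜 n g (Metric.ball 0 ρ) ∧
      (∀ ε ∈ Metric.ball (0 : 𝕜) ρ, f ε = ε ^ i • g ε) ∧ g 0 = S := by
  obtain ⟨c, g, hg, hfg⟩ := exists_expansion n i hf
  have hlit : (fun ε : 𝕜 => ε ^ (i + 1)) =o[𝓝 0] fun ε : 𝕜 => ε ^ i :=
    isLittleO_pow_pow (Nat.lt_succ_self i)
  have key : ∀ x, (∀ j < i, c j x = 0) ∧ g 0 x = S x := fun x =>
    expansion_unique (f := fun ε => f ε x) (c := fun j => c j x) (g := fun ε => g ε x)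
      ((continuousAt_zero_of_contDiffOn hρ hg).clm_apply continuousAt_const)
      (by
        filter_upwards [Metric.ball_mem_nhds (0 : 𝕜) hρ] with ε hε
        rw [hfg ε hε]
        simp only [add_apply, sum_apply, smul_apply]) ((h x).trans_isLittleO hlit)
  refine ⟨g, hg, fun ε hε => ?_, ContinuousLinearMap.ext fun x => (key x).2⟩
  rw [hfg ε hε, Finset.sum_eq_zero fun j hj => ?_, zero_add]
  rw [show c j = 0 from ContinuousLinearMap.ext fun x => (key x).1 j (Finset.mem_range.1 hj),
    smul_zero]

theorem hasDerivAt_of_eq_add_smul {f c : 𝕜 → F} (hc : ContinuousAt c 0)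
    (h : ∀ᶠ ε in 𝓝 0, f ε = f 0 + ε • c ε) : HasDerivAt f (c 0) 0 := by
  rw [hasDerivAt_iff_tendsto_slope]
  refine (tendsto_nhdsWithin_of_tendsto_nhds hc.tendsto).congr' ?_
  filter_upwards [self_mem_nhdsWithin, nhdsWithin_le_nhds h] with ε hε h
  have hε : ε ≠ 0 := hε
  rw [slope_def_module, h, sub_zero, add_sub_cancel_left, smul_smul, inv_mul_cancel₀ hε, one_smul]

end Taylor

noncomputable section

/-! ### Finite direct sums of closed subspaces -/

section ClosedSum

variable {𝕜 : Type*} [RCLike 𝕜] {E : Type*} [NormedAddCommGroup E] [NormedSpace 𝕜 E]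
  [CompleteSpace E] {ι : Type*} [Fintype ι] [DecidableEq ι] {A : ι → Submodule 𝕜 E}

theorem coeLinearMap_linearEquivFunOnFintype_symm (x : ∀ i, A i) :
    DirectSum.coeLinearMap A ((DirectSum.linearEquivFunOnFintype 𝕜 ι fun i => A i).symm x)
      = ∑ i, (x i : E) := by
  classical
  rw [DirectSum.coeLinearMap_eq_dfinsuppSum, DFinsupp.sum_eq_sum_fintype]
  · rfl
  · intro i; simp

/-- A finite internal direct sum of closed subspaces of a Banach space is a topological one. -/
theorem exists_equiv_of_isInternal (hc : ∀ i, IsClosed (A i : Set E))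
    (h : DirectSum.IsInternal A) :
    ∃ e : (∀ i, A i) ≃L[𝕜] E, ∀ x, e x = ∑ i, (x i : E) := by
  have _ : ∀ i, CompleteSpace (A i) := fun i => (hc i).completeSpace_coe
  let f : (∀ i, A i) →L[𝕜] E :=
    ∑ i, (A i).subtypeL.comp (ContinuousLinearMap.proj (R := 𝕜) (φ := fun i => A i) i)
  have hf : ∀ x, f x = ∑ i, (x i : E) := fun x => by
    simp only [f, sum_apply]
    rfl
  have hf' : ∀ x, f x = DirectSum.coeLinearMap A
      ((DirectSum.linearEquivFunOnFintype 𝕜 ι fun i => A i).symm x) := fun x => by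
    rw [hf, coeLinearMap_linearEquivFunOnFintype_symm]
  have hb : Function.Bijective f := by
    have : (f : (∀ i, A i) → E) = DirectSum.coeLinearMap A ∘
      (DirectSum.linearEquivFunOnFintype 𝕜 ι fun i => A i).symm := funext hf'
    rw [this]
    exact Function.Bijective.comp h (LinearEquiv.bijective _)
  -- The inverse is continuous by the open mapping theorem; closedness of the summands makes their
  -- product complete.
  refine ⟨ContinuousLinearEquiv.ofBijective f (LinearMap.ker_eq_bot.2 hb.1)
    (LinearMap.range_eq_top.2 hb.2), fun x => ?_⟩
  rw [← hf]
  rfl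

variable (hc : ∀ i, IsClosed (A i : Set E)) (h : DirectSum.IsInternal A)

/-- The topological isomorphism of a direct sum of closed subspaces. -/
def sumEquiv : (∀ i, A i) ≃L[𝕜] E := (exists_equiv_of_isInternal hc h).choose

theorem sumEquiv_apply (x : ∀ i, A i) : sumEquiv hc h x = ∑ i, (x i : E) :=
  (exists_equiv_of_isInternal hc h).choose_spec x

/-- The continuous projection to a summand of a direct sum of closed subspaces. -/
def sumProj (i : ι) : E →L[𝕜] A i :=
  (ContinuousLinearMap.proj (R := 𝕜) (φ := fun i => A i) i).comp
    (sumEquiv hc h).symm.toContinuousLinearMap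

theorem sumProj_apply (i : ι) (x : E) : sumProj hc h i x = (sumEquiv hc h).symm x i := rfl

theorem sum_sumProj (x : E) : ∑ i, (sumProj hc h i x : E) = x := by
  simp only [sumProj_apply]
  rw [← sumEquiv_apply hc h, ContinuousLinearEquiv.apply_symm_apply]

theorem sumEquiv_symm_coe (i : ι) (a : A i) : (sumEquiv hc h).symm (a : E) = Pi.single i a := by
  rw [ContinuousLinearEquiv.symm_apply_eq, sumEquiv_apply, Finset.sum_eq_single i]
  · simp
  · intro j _ hj; simp [Pi.single_eq_of_ne hj]
  · simp

theorem sumProj_coe (i : ι) (a : A i) : sumProj hc h i (a : E) = a := by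
  rw [sumProj_apply, sumEquiv_symm_coe, Pi.single_eq_same]

theorem sumProj_coe_of_ne {i j : ι} (hij : j ≠ i) (a : A i) : sumProj hc h j (a : E) = 0 := by
  rw [sumProj_apply, sumEquiv_symm_coe, Pi.single_eq_of_ne hij]

theorem mem_iSup_iff_sumProj (p : ι → Prop) (x : E) :
    x ∈ (⨆ (j : ι) (_ : p j), A j) ↔ ∀ j, ¬ p j → sumProj hc h j x = 0 := by
  constructor
  · intro hx j hj
    have : (⨆ (j : ι) (_ : p j), A j) ≤ (sumProj hc h j : E →ₗ[𝕜] A j).ker := by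
      refine iSup₂_le fun i hi a ha => ?_
      have hne : j ≠ i := fun e => hj (e ▸ hi)
      exact sumProj_coe_of_ne hc h hne ⟨a, ha⟩
    exact this hx
  · intro hx
    rw [← sum_sumProj hc h x]
    refine Submodule.sum_mem _ fun j _ => ?_
    by_cases hj : p j
    · exact Submodule.mem_iSup_of_mem j (Submodule.mem_iSup_of_mem hj (Subtype.prop _))
    · rw [hx j hj]; simp

theorem directProj_eq_sumProj (i : ι) (x : E) : directProj A h i x = sumProj hc h i x := by
  have : (LinearEquiv.ofBijective (DirectSum.coeLinearMap A) h).symm x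
      = (DirectSum.linearEquivFunOnFintype 𝕜 ι fun i => A i).symm ((sumEquiv hc h).symm x) := by
    rw [LinearEquiv.symm_apply_eq]
    refine Eq.trans ?_ (coeLinearMap_linearEquivFunOnFintype_symm _).symm
    rw [← sumEquiv_apply hc h, ContinuousLinearEquiv.apply_symm_apply]
  unfold directProj
  rw [LinearMap.comp_apply, LinearEquiv.coe_coe, this]
  rfl

end ClosedSum

/-! ### Rank and leading coefficients in terms of the projections of a splitting -/

namespace JordanSplitting

variable {𝕜 : Type*} [RCLike 𝕜]
  {B : Type*} [NormedAddCommGroup B] [NormedSpace 𝕜 B] [CompleteSpace B]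
  {B' : Type*} [NormedAddCommGroup B'] [NormedSpace 𝕜 B'] [CompleteSpace B']
  {L : 𝕜 → B →L[𝕜] B'} {k : ℕ} (D : JordanSplitting L k)

theorem isClosed_elim (o : Option (Fin (k + 1))) :
    IsClosed ((o.elim D.N D.Nc : Submodule 𝕜 B) : Set B) := by
  cases o with
  | none => exact D.isClosed_N
  | some i => exact D.isClosed_Nc i

/-- The projection of `B` to `Nc i`. -/
def projNc (i : Fin (k + 1)) : B →L[𝕜] D.Nc i :=
  sumProj D.isClosed_elim D.isInternal_domain (some i)

/-- The projection of `B'` to `R i`. -/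
def projR (i : Fin (k + 1)) : B' →L[𝕜] D.R i :=
  sumProj D.isClosed_R D.isInternal_R i

theorem projNc_coe (i : Fin (k + 1)) (n : D.Nc i) : D.projNc i (n : B) = n :=
  sumProj_coe D.isClosed_elim D.isInternal_domain (some i) n

theorem projNc_coe_of_ne {i j : Fin (k + 1)} (h : j ≠ i) (n : D.Nc i) :
    D.projNc j (n : B) = 0 :=
  sumProj_coe_of_ne D.isClosed_elim D.isInternal_domain (i := some i) (j := some j)
    (by simpa using h) n

theorem projNc_coe_N (j : Fin (k + 1)) (n : D.N) : D.projNc j (n : B) = 0 :=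
  sumProj_coe_of_ne D.isClosed_elim D.isInternal_domain (i := none) (j := some j) (by simp) n

theorem sum_projR (y : B') : ∑ i, (D.projR i y : B') = y :=
  sum_sumProj D.isClosed_R D.isInternal_R y

theorem projR_coe (i : Fin (k + 1)) (y : D.R i) : D.projR i (y : B') = y :=
  sumProj_coe D.isClosed_R D.isInternal_R i y

theorem projR_coe_of_ne {i j : Fin (k + 1)} (h : j ≠ i) (y : D.R i) :
    D.projR j (y : B') = 0 :=
  sumProj_coe_of_ne D.isClosed_R D.isInternal_R h y

theorem directProj_R (i : Fin (k + 1)) (y : B') :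
    directProj D.R D.isInternal_R i y = D.projR i y :=
  directProj_eq_sumProj D.isClosed_R D.isInternal_R i y

theorem rankGE_iff {i : ℕ} (hi : i ≤ k + 1) (b : B) :
    RankGE L i b ↔ ∀ j : Fin (k + 1), (j : ℕ) < i → D.projNc j b = 0 := by
  have h := mem_iSup_iff_sumProj D.isClosed_elim D.isInternal_domain
    (fun o => o.elim True fun j : Fin (k + 1) => i ≤ (j : ℕ)) b
  rw [iSup_option] at h
  simp only [Option.elim_none, Option.elim_some, iSup_pos] at h
  rw [← D.rank_iff i hi b, sup_comm, h, Option.forall]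
  simp only [Option.elim_none, Option.elim_some, not_true, false_imp_iff, true_and, not_le]
  rfl

theorem isLeadingCoeff_iff {i : ℕ} (hi : i ≤ k) (y : B') :
    IsLeadingCoeff L i y ↔ ∀ j : Fin (k + 1), i < (j : ℕ) → D.projR j y = 0 := by
  rw [← D.leadingCoeff_iff i hi y, mem_iSup_iff_sumProj D.isClosed_R D.isInternal_R]
  simp only [not_le]
  rfl

end JordanSplitting
end

noncomputable section

/-! ### Coefficients of power series and order estimates -/

section Conv

variable {𝕜 : Type*} [RCLike 𝕜]
  {B : Type*} [NormedAddCommGroup B] [NormedSpace 𝕜 B]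
  {B' : Type*} [NormedAddCommGroup B'] [NormedSpace 𝕜 B']

/-- The coefficient of order `n` of the product of two power series. -/
def conv (ℓ : ℕ → B →L[𝕜] B') (b : ℕ → B) (n : ℕ) : B' :=
  ∑ j ∈ Finset.range (n + 1), ℓ (n - j) (b j)

theorem conv_sub (ℓ : ℕ → B →L[𝕜] B') (b c : ℕ → B) (n : ℕ) :
    conv ℓ (fun j => b j - c j) n = conv ℓ b n - conv ℓ c n := by
  simp [conv, Finset.sum_sub_distrib]

theorem conv_sum (ℓ : ℕ → B →L[𝕜] B') {ι : Type*} (s : Finset ι) (b : ι → ℕ → B) (n : ℕ) :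
    conv ℓ (fun j => ∑ i ∈ s, b i j) n = ∑ i ∈ s, conv ℓ (b i) n := by
  simp only [conv, map_sum]
  rw [Finset.sum_comm]

theorem conv_zero (ℓ : ℕ → B →L[𝕜] B') (n : ℕ) : conv ℓ (fun _ => 0) n = 0 := by
  simp [conv]

/-- This is multiplication of the curve by ε^d, the operation by which lower chains are used as
corrections. -/
theorem conv_shift (ℓ : ℕ → B →L[𝕜] B') (b : ℕ → B) (d n : ℕ) :
    conv ℓ (fun j => if d ≤ j then b (j - d) else 0) n = if d ≤ n then conv ℓ b (n - d) else 0 := by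
  unfold conv
  beta_reduce
  split_ifs with h
  · obtain ⟨e, rfl⟩ := Nat.exists_eq_add_of_le h
    rw [add_assoc, Finset.sum_range_add, Finset.sum_eq_zero, zero_add]
    · rw [Nat.add_sub_cancel_left]
      refine Finset.sum_congr rfl fun j _ => ?_
      rw [if_pos (by omega), Nat.add_sub_cancel_left, Nat.add_sub_add_left]
    · intro j hj
      rw [Finset.mem_range] at hj
      rw [if_neg (by omega), map_zero]
  · refine Finset.sum_eq_zero fun j hj => ?_
    rw [Finset.mem_range] at hj
    rw [if_neg (by omega), map_zero]

theorem conv_succ_of_zero (ℓ : ℕ → B →L[𝕜] B') {b : ℕ → B} (hb : b 0 = 0) (n : ℕ) :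
    conv ℓ b (n + 1) = conv ℓ (fun j => b (j + 1)) n := by
  unfold conv
  rw [Finset.sum_range_succ', hb, map_zero, add_zero]
  refine Finset.sum_congr rfl fun j _ => ?_
  rw [Nat.add_sub_add_right]

/-- The family `L` has the Taylor coefficients `ℓ` up to the order `K`. -/
def HasCoeffs (L : 𝕜 → B →L[𝕜] B') (ℓ : ℕ → B →L[𝕜] B') (K : ℕ) : Prop :=
  ∀ l ≤ K, (fun ε : 𝕜 => L ε - ∑ a ∈ Finset.range l, ε ^ a • ℓ a) =O[𝓝 0] fun ε : 𝕜 => ε ^ l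

theorem pow_isBigO_pow {m n : ℕ} (h : n ≤ m) :
    (fun ε : 𝕜 => ε ^ m) =O[𝓝 0] fun ε : 𝕜 => ε ^ n := by
  obtain ⟨e, rfl⟩ := Nat.exists_eq_add_of_le h
  have h1 : (fun ε : 𝕜 => ε ^ e) =O[𝓝 0] fun _ : 𝕜 => (1 : 𝕜) :=
    (continuous_pow e).continuousAt.isBigO_one 𝕜
  simpa [pow_add] using (isBigO_refl (fun ε : 𝕜 => ε ^ n) (𝓝 0)).mul h1

variable {L : 𝕜 → B →L[𝕜] B'} {ℓ : ℕ → B →L[𝕜] B'} {K : ℕ}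

/-- The term with ε^j needs `L` only to order l - j. The curve may have more than `l` terms, because
pₖ(ε) has k + 1 of them whatever the order considered. -/
theorem HasCoeffs.apply_sum_sub_isBigO (hL : HasCoeffs L ℓ K) {l m : ℕ} (hl : l ≤ K) (hm : l ≤ m)
    (b : ℕ → B) :
    (fun ε : 𝕜 => L ε (∑ j ∈ Finset.range m, ε ^ j • b j)
      - ∑ n ∈ Finset.range l, ε ^ n • conv ℓ b n) =O[𝓝 0] fun ε : 𝕜 => ε ^ l := by
  have key : ∀ ε : 𝕜, L ε (∑ j ∈ Finset.range m, ε ^ j • b j)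
      - ∑ n ∈ Finset.range l, ε ^ n • conv ℓ b n
      = ∑ j ∈ Finset.range m, ε ^ j • (L ε - ∑ a ∈ Finset.range (l - j), ε ^ a • ℓ a) (b j) := by
    intro ε
    have e1 : ∑ n ∈ Finset.range l, ε ^ n • conv ℓ b n
        = ∑ j ∈ Finset.range m, ∑ a ∈ Finset.range (l - j), ε ^ (j + a) • ℓ a (b j) := by
      have e2 := Finset.sum_range_diag_flip l fun j a => ε ^ (j + a) • ℓ a (b j)
      have e3 : ∑ j ∈ Finset.range m, ∑ a ∈ Finset.range (l - j), ε ^ (j + a) • ℓ a (b j)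
          = ∑ j ∈ Finset.range l, ∑ a ∈ Finset.range (l - j), ε ^ (j + a) • ℓ a (b j) := by
        symm
        refine Finset.sum_subset (Finset.range_subset_range.2 hm) fun j _ hj => ?_
        rw [Finset.mem_range, not_lt] at hj
        rw [Nat.sub_eq_zero_of_le hj, Finset.range_zero, Finset.sum_empty]
      rw [e3, ← e2]
      refine Finset.sum_congr rfl fun n _ => ?_
      rw [conv, Finset.smul_sum]
      refine Finset.sum_congr rfl fun j hj => ?_
      rw [Finset.mem_range] at hj
      rw [Nat.add_sub_cancel' (by omega)]
    rw [e1, map_sum, ← Finset.sum_sub_distrib]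
    refine Finset.sum_congr rfl fun j _ => ?_
    simp only [map_smul, sub_apply, sum_apply, smul_apply, smul_sub, Finset.smul_sum, smul_smul,
      pow_add]
  simp only [key]
  refine IsBigO.fun_sum fun j _ => ?_
  have h1 := hL (l - j) (by omega)
  have h2 : (fun ε : 𝕜 => (L ε - ∑ a ∈ Finset.range (l - j), ε ^ a • ℓ a) (b j)) =O[𝓝 0]
      fun ε : 𝕜 => ε ^ (l - j) :=
    ((ContinuousLinearMap.apply 𝕜 B' (b j)).isBigO_comp _ _).trans h1
  refine ((isBigO_refl (fun ε : 𝕜 => ε ^ j) (𝓝 0)).smul h2).trans ?_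
  simp only [smul_eq_mul, ← pow_add]
  exact pow_isBigO_pow (by omega)

theorem HasCoeffs.apply_sum_sub_isBigO_iff (hL : HasCoeffs L ℓ K) {l m : ℕ} (hl : l ≤ K)
    (hm : l ≤ m) (b : ℕ → B) (c : ℕ → B') :
    ((fun ε : 𝕜 => L ε (∑ j ∈ Finset.range m, ε ^ j • b j)
      - ∑ n ∈ Finset.range l, ε ^ n • c n) =O[𝓝 0] fun ε : 𝕜 => ε ^ l)
      ↔ ∀ n < l, conv ℓ b n = c n := by
  have h := hL.apply_sum_sub_isBigO hl hm b
  constructor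
  · intro h'
    have h2 := (h'.sub h).mono (nhdsWithin_le_nhds (s := {0}ᶜ))
    have h3 := eq_zero_of_sum_pow_isBigO (i := l) (c := fun n => conv ℓ b n - c n)
      (h2.congr_left fun ε => by
        rw [sub_sub_sub_cancel_left, ← Finset.sum_sub_distrib]
        exact Finset.sum_congr rfl fun n _ => (smul_sub _ _ _).symm)
    exact fun n hn => sub_eq_zero.1 (h3 n hn)
  · intro hc
    refine h.congr_left fun ε => ?_
    congr 1
    refine Finset.sum_congr rfl fun n hn => ?_
    rw [hc n (Finset.mem_range.1 hn)]

theorem sum_pow_smul_ite (i : ℕ) (y : B') (ε : 𝕜) :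
    ∑ n ∈ Finset.range (i + 1), ε ^ n • (if n = i then y else 0) = ε ^ i • y := by
  rw [Finset.sum_eq_single i]
  · simp
  · intro j _ hj; simp [hj]
  · simp

theorem HasCoeffs.rankGE_iff (hL : HasCoeffs L ℓ K) {i : ℕ} (hi : i ≤ K) (b₀ : B) :
    RankGE L i b₀ ↔ ∃ b : ℕ → B, b 0 = b₀ ∧ ∀ n < i, conv ℓ b n = 0 := by
  refine exists_congr fun b => and_congr_right fun _ => ?_
  rw [← hL.apply_sum_sub_isBigO_iff hi le_rfl b fun _ => 0]
  simp

theorem HasCoeffs.isLeadingCoeff_iff (hL : HasCoeffs L ℓ K) {i : ℕ} (hi : i + 1 ≤ K) (y : B') :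
    IsLeadingCoeff L i y ↔ ∃ b : ℕ → B, (∀ n < i, conv ℓ b n = 0) ∧ conv ℓ b i = y := by
  refine exists_congr fun b => ?_
  have h := hL.apply_sum_sub_isBigO_iff hi le_rfl b fun n => if n = i then y else 0
  simp only [sum_pow_smul_ite] at h
  rw [h]
  constructor
  · intro h
    exact ⟨fun n hn => by rw [h n (by omega), if_neg (by omega)], by rw [h i (by omega), if_pos rfl]⟩
  · rintro ⟨h1, h2⟩ n hn
    split_ifs with hni
    · rw [hni, h2]
    · exact h1 n (by omega)

end Conv

/-! ### Inductive construction of the Jordan chains -/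

section Chains

variable {𝕜 : Type*} [RCLike 𝕜]
  {B : Type*} [NormedAddCommGroup B] [NormedSpace 𝕜 B] [CompleteSpace B]
  {B' : Type*} [NormedAddCommGroup B'] [NormedSpace 𝕜 B'] [CompleteSpace B']
  {L : 𝕜 → B →L[𝕜] B'} {k : ℕ} (D : JordanSplitting L k)

namespace JordanSplitting

/-- The sum of the first `m` summands of the domain. -/
def partialSum (m : ℕ) : Submodule 𝕜 B := ⨆ (j : Fin (k + 1)) (_ : (j : ℕ) < m), D.Nc j

theorem partialSum_mono {m n : ℕ} (h : m ≤ n) : D.partialSum m ≤ D.partialSum n :=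
  iSup_mono fun _ => iSup_mono' fun hj => ⟨lt_of_lt_of_le hj h, le_rfl⟩

theorem Nc_le_partialSum {j : Fin (k + 1)} {m : ℕ} (h : (j : ℕ) < m) :
    D.Nc j ≤ D.partialSum m := fun _ hx =>
  Submodule.mem_iSup_of_mem j (Submodule.mem_iSup_of_mem h hx)

/-- The elements whose first `i` components vanish; those of rank at least `i`. -/
def InTail (i : ℕ) (b : B) : Prop := ∀ j : Fin (k + 1), (j : ℕ) < i → D.projNc j b = 0

theorem InTail.mono {i j : ℕ} (h : j ≤ i) {b : B} (hb : D.InTail i b) : D.InTail j b :=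
  fun l hl => hb l (by omega)

theorem inTail_coe {i : ℕ} {j : Fin (k + 1)} (h : i ≤ (j : ℕ)) (n : D.Nc j) :
    D.InTail i (n : B) := fun l hl =>
  D.projNc_coe_of_ne (fun e => by subst e; omega) n

variable {ℓ : ℕ → B →L[𝕜] B'}

theorem inTail_iff_conv (hL : HasCoeffs L ℓ (k + 1)) {i : ℕ} (hi : i ≤ k + 1) (b₀ : B) :
    D.InTail i b₀ ↔ ∃ b : ℕ → B, b 0 = b₀ ∧ ∀ n < i, conv ℓ b n = 0 :=
  (D.rankGE_iff hi b₀).symm.trans (hL.rankGE_iff hi b₀)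

theorem projR_eq_zero_iff_conv (hL : HasCoeffs L ℓ (k + 1)) {i : ℕ} (hi : i ≤ k) (y : B') :
    (∀ j : Fin (k + 1), i < (j : ℕ) → D.projR j y = 0) ↔
      ∃ b : ℕ → B, (∀ n < i, conv ℓ b n = 0) ∧ conv ℓ b i = y :=
  (D.isLeadingCoeff_iff hi y).symm.trans (hL.isLeadingCoeff_iff (by omega) y)

/-- A curve without constant term is ε times another curve, so its coefficient of order i is a
leading coefficient of order i - 1 and has no component in `R i`. Applied to the difference of two
chains with the same root, it makes that component depend on the root only. -/
theorem projR_conv_eq_zero (hL : HasCoeffs L ℓ (k + 1)) {d : ℕ → B} (hd : d 0 = 0)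
    (i : Fin (k + 1)) (h : ∀ n < (i : ℕ), conv ℓ d n = 0) : D.projR i (conv ℓ d i) = 0 := by
  rcases Nat.eq_zero_or_pos (i : ℕ) with hi | hi
  · rw [hi]
    simp [conv, hd]
  · obtain ⟨m, hm⟩ := Nat.exists_eq_succ_of_ne_zero hi.ne'
    refine (D.projR_eq_zero_iff_conv hL (i := m) (by omega) _).2 ⟨fun j => d (j + 1), ?_, ?_⟩
      i (by omega)
    · intro n hn
      rw [← conv_succ_of_zero ℓ hd]
      exact h _ (by omega)
    · rw [← conv_succ_of_zero ℓ hd, hm]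

/-- The first `i` steps of the construction of the Jordan chains. -/
structure ChainStage (ℓ : ℕ → B →L[𝕜] B') (i : ℕ) (φ : ℕ → B →L[𝕜] B) : Prop where
  zero : φ 0 = ContinuousLinearMap.id 𝕜 B
  mem : ∀ l, 1 ≤ l → ∀ b, φ l b ∈ D.partialSum (i - l)
  mem_Nc : ∀ l, ∀ j : Fin (k + 1), ∀ n : D.Nc j, φ l (n : B) ∈ D.partialSum (j + 1 - l)
  iso : ∀ j : Fin (k + 1), (j : ℕ) < i → ∃ S : D.Nc j ≃L[𝕜] D.R j,
    ∀ b, D.InTail j b → conv ℓ (fun m => φ m b) j = S (D.projNc j b)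

theorem chainStage_zero : D.ChainStage ℓ 0
    fun l => if l = 0 then ContinuousLinearMap.id 𝕜 B else 0 where
  zero := by simp
  mem l hl b := by
    rw [if_neg (by omega)]
    exact Submodule.zero_mem _
  mem_Nc l j n := by
    split_ifs with h
    · subst h
      exact D.Nc_le_partialSum (by omega) n.2
    · exact Submodule.zero_mem _
  iso j hj := by omega

variable {D} in
theorem ChainStage.conv_eq_zero {i : ℕ} {φ : ℕ → B →L[𝕜] B} (h : D.ChainStage ℓ i φ) {n m : ℕ}
    (hn : n < i) (hnm : n < m) (hm : m ≤ k + 1) {b : B} (hb : D.InTail m b) :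
    conv ℓ (fun l => φ l b) n = 0 := by
  obtain ⟨S, hS⟩ := h.iso ⟨n, by omega⟩ hn
  have := hS b (hb.mono D (by simp; omega))
  rw [hb ⟨n, by omega⟩ hnm, map_zero] at this
  simpa using this

variable {D} in
-- The roots of the correcting chains are obtained by applying the inverses of the isomorphisms
-- already constructed to the components of `A b`.
theorem ChainStage.exists_correction {i : ℕ} {φ : ℕ → B →L[𝕜] B} (h : D.ChainStage ℓ i φ)
    (A : B →L[𝕜] B') :
    ∃ E : Fin (k + 1) → B →L[𝕜] B, (∀ j b, E j b ∈ D.Nc j) ∧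
      (∀ j b, A b = 0 → E j b = 0) ∧
      ∀ j : Fin (k + 1), (j : ℕ) < i → ∀ b, conv ℓ (fun l => φ l (E j b)) j = D.projR j (A b) := by
  choose S hS using h.iso
  refine ⟨fun j => if hj : (j : ℕ) < i then (D.Nc j).subtypeL.comp
    ((S j hj).symm.toContinuousLinearMap.comp ((D.projR j).comp A)) else 0, ?_, ?_, ?_⟩
  all_goals beta_reduce
  · intro j b
    split_ifs with hj
    · exact Subtype.prop _
    · exact Submodule.zero_mem _
  · intro j b hb
    split_ifs with hj
    · simp [hb]
    · rfl
  · intro j hj b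
    rw [dif_pos hj]
    have hn : ((D.Nc j).subtypeL.comp
      ((S j hj).symm.toContinuousLinearMap.comp ((D.projR j).comp A))) b
        = ((S j hj).symm (D.projR j (A b)) : B) := rfl
    rw [hn, hS j hj _ (D.inTail_coe le_rfl _), D.projNc_coe, ContinuousLinearEquiv.apply_symm_apply]

variable {D} in
theorem ChainStage.succ (hL : HasCoeffs L ℓ (k + 1)) {i : ℕ} (hi : i < k + 1)
    {φ : ℕ → B →L[𝕜] B} (h : D.ChainStage ℓ i φ) : ∃ φ', D.ChainStage ℓ (i + 1) φ' := by
  set I : Fin (k + 1) := ⟨i, hi⟩ with hI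
  -- `Q` removes the components of rank below i. Hence the correction leaves the finished chains of
  -- lower rank untouched, as the range condition `mem_Nc` requires.
  let Q : B →L[𝕜] B := ContinuousLinearMap.id 𝕜 B
    - ∑ j : Fin (k + 1), if (j : ℕ) < i then (D.Nc j).subtypeL.comp (D.projNc j) else 0
  have hQ : ∀ b, Q b = b - ∑ j : Fin (k + 1), if (j : ℕ) < i then (D.projNc j b : B) else 0 := by
    intro b
    simp only [Q, sub_apply, sum_apply, ContinuousLinearMap.id_apply]
    congr 1
    refine Finset.sum_congr rfl fun j _ => ?_
    split_ifs <;> rfl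
  have hQtail : ∀ b, D.InTail i b → Q b = b := by
    intro b hb
    rw [hQ, Finset.sum_eq_zero, sub_zero]
    intro j _
    split_ifs with hj
    · rw [hb j hj]; rfl
    · rfl
  have hQ0 : ∀ j : Fin (k + 1), (j : ℕ) < i → ∀ n : D.Nc j, Q (n : B) = 0 := by
    intro j hj n
    rw [hQ, Finset.sum_eq_single j, if_pos hj, D.projNc_coe, sub_self]
    · intro l _ hl
      rw [D.projNc_coe_of_ne hl]
      simp
    · simp
  let T : B →L[𝕜] B' := ∑ m ∈ Finset.range (i + 1), (ℓ (i - m)).comp (φ m)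
  have hT : ∀ b, T b = conv ℓ (fun m => φ m b) i := by
    intro b
    simp [T, conv, sum_apply]
  obtain ⟨E, hEmem, hE0, hE⟩ := h.exists_correction (T.comp Q)
  -- The chain with root `E j b` has leading order j; the shift by i - j moves it to order i, where
  -- it cancels the `R j` component. The shift is at least 1, so roots are unchanged.
  let φ' : ℕ → B →L[𝕜] B := fun l => φ l - ∑ j : Fin (k + 1),
    if (j : ℕ) < i ∧ i - (j : ℕ) ≤ l then (φ (l - (i - (j : ℕ)))).comp (E j) else 0
  have hφ' : ∀ l b, φ' l b = φ l b - ∑ j : Fin (k + 1),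
      if (j : ℕ) < i then (if i - (j : ℕ) ≤ l then φ (l - (i - (j : ℕ))) (E j b) else 0)
        else 0 := by
    intro l b
    simp only [φ', sub_apply, sum_apply]
    congr 1
    refine Finset.sum_congr rfl fun j _ => ?_
    by_cases h1 : (j : ℕ) < i <;> by_cases h2 : i - (j : ℕ) ≤ l <;> simp [h1, h2]
  have hconv : ∀ n b, conv ℓ (fun l => φ' l b) n = conv ℓ (fun l => φ l b) n
      - ∑ j : Fin (k + 1), if (j : ℕ) < i then
        (if i - (j : ℕ) ≤ n then conv ℓ (fun l => φ l (E j b)) (n - (i - (j : ℕ))) else 0)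
          else 0 := by
    intro n b
    simp only [hφ']
    rw [conv_sub, conv_sum]
    congr 1
    refine Finset.sum_congr rfl fun j _ => ?_
    split_ifs with h1 h2
    · simpa [h2] using conv_shift ℓ (fun l => φ l (E j b)) (i - j) n
    · simpa [h2] using conv_shift ℓ (fun l => φ l (E j b)) (i - j) n
    · exact conv_zero ℓ n
  have hEtail : ∀ (j : Fin (k + 1)) b, D.InTail (j : ℕ) (E j b) := fun j b => D.inTail_coe le_rfl ⟨_, hEmem j b⟩
  have hlow : ∀ n < i, ∀ b, conv ℓ (fun l => φ' l b) n = conv ℓ (fun l => φ l b) n := by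
    intro n hn b
    rw [hconv, Finset.sum_eq_zero, sub_zero]
    intro j _
    split_ifs with h1 h2
    · exact h.conv_eq_zero (by omega) (by omega) j.2.le (hEtail j b)
    · rfl
    · rfl
  have hlow0 : ∀ n < i, ∀ b, D.InTail i b → conv ℓ (fun l => φ' l b) n = 0 := by
    intro n hn b hb
    rw [hlow n hn]
    exact h.conv_eq_zero hn hn hi.le hb
  -- Components beyond `I` vanish since `T b` is a leading coefficient of order i; those before `I`
  -- are cancelled by the correction.
  have htop : ∀ b, D.InTail i b → conv ℓ (fun l => φ' l b) i = D.projR I (T b) := by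
    intro b hb
    have hW := (D.projR_eq_zero_iff_conv hL (i := i) (by omega) (T b)).2
      ⟨fun l => φ l b, fun n hn => h.conv_eq_zero hn hn hi.le hb, (hT b).symm⟩
    rw [hconv, ← hT]
    have e1 : ∀ j : Fin (k + 1), (if (j : ℕ) < i then
        (if i - (j : ℕ) ≤ i then conv ℓ (fun l => φ l (E j b)) (i - (i - (j : ℕ))) else 0)
          else 0) = if (j : ℕ) < i then (D.projR j (T b) : B') else 0 := by
      intro j
      split_ifs with h1 h2
      · rw [Nat.sub_sub_self h1.le, hE j h1 b, ContinuousLinearMap.comp_apply, hQtail b hb]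
      · omega
      · rfl
    simp only [e1]
    rw [sub_eq_iff_eq_add]
    nth_rewrite 1 [← D.sum_projR (T b)]
    have e2 : ∀ j : Fin (k + 1), (D.projR j (T b) : B') =
        (if j = I then (D.projR I (T b) : B') else 0)
          + if (j : ℕ) < i then (D.projR j (T b) : B') else 0 := by
      intro j
      rcases lt_trichotomy (j : ℕ) i with hj | hj | hj
      · have : j ≠ I := fun e => by rw [e] at hj; exact lt_irrefl _ hj
        simp [hj, this]
      · have : j = I := Fin.ext hj
        subst this
        simp [hI]
      · have : j ≠ I := fun e => by rw [e] at hj; exact lt_irrefl _ hj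
        rw [hW j hj]
        simp [this]
    rw [Finset.sum_congr rfl fun j _ => e2 j, Finset.sum_add_distrib]
    simp
  have hzero : φ' 0 = ContinuousLinearMap.id 𝕜 B := by
    simp only [φ', h.zero]
    rw [Finset.sum_eq_zero, sub_zero]
    intro j _
    rw [if_neg (by omega)]
  have hzero' : ∀ b, φ' 0 b = b := fun b => by rw [hzero]; rfl
  have hdefect : ∀ b, D.InTail i b → ∀ c : ℕ → B, c 0 = b → (∀ n < i, conv ℓ c n = 0) →
      D.projR I (conv ℓ (fun l => φ' l b) i) = D.projR I (conv ℓ c i) := by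
    intro b hb c hc0 hc
    have := D.projR_conv_eq_zero hL (d := fun l => φ' l b - c l) (by simp [hzero', hc0]) I
      (fun n hn => by rw [conv_sub, hlow0 n hn b hb, hc n hn, sub_zero])
    rwa [conv_sub, map_sub, sub_eq_zero] at this
  -- Some chain with root `b` has zero coefficient at order i. By `hdefect` the new chain has zero
  -- component in `R I`, which by `htop` is its whole coefficient.
  have hnext : ∀ b, D.InTail (i + 1) b → conv ℓ (fun l => φ' l b) i = 0 := by
    intro b hb
    have hb' : D.InTail i b := hb.mono D (by omega)
    obtain ⟨c, hc0, hc⟩ := (D.inTail_iff_conv hL (i := i + 1) (by omega) b).1 hb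
    have := hdefect b hb' c hc0 fun n hn => hc n (by omega)
    rw [hc i (by omega), map_zero, htop b hb', D.projR_coe] at this
    rw [htop b hb', this]
    rfl
  let S₀ : D.Nc I →L[𝕜] D.R I := (D.projR I).comp (T.comp (D.Nc I).subtypeL)
  have hS₀ : ∀ n : D.Nc I, (S₀ n : B') = conv ℓ (fun l => φ' l (n : B)) i := fun n => by
    rw [htop _ (D.inTail_coe (i := i) (j := I) le_rfl n)]
    rfl
  have hS : ∀ b, D.InTail i b → conv ℓ (fun l => φ' l b) i = S₀ (D.projNc I b) := by
    intro b hb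
    have h1 : D.InTail (i + 1) (b - (D.projNc I b : B)) := by
      intro j hj
      rw [map_sub]
      rcases Nat.lt_succ_iff_lt_or_eq.1 hj with hj | hj
      · rw [hb j hj, D.projNc_coe_of_ne (fun e => by rw [e] at hj; exact lt_irrefl _ hj), sub_zero]
      · have : j = I := Fin.ext hj
        rw [this, D.projNc_coe, sub_self]
    have h2 := hnext _ h1
    simp only [map_sub] at h2
    rw [conv_sub, sub_eq_zero] at h2
    rw [h2, hS₀]
  have hinj : Function.Injective S₀ := by
    rw [injective_iff_map_eq_zero]
    intro n hn
    have h1 : D.InTail (i + 1) (n : B) := by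
      refine (D.inTail_iff_conv hL (by omega) _).2 ⟨fun l => φ' l (n : B), hzero' _, ?_⟩
      intro m hm
      rcases Nat.lt_succ_iff_lt_or_eq.1 hm with hm | hm
      · exact hlow0 m hm _ (D.inTail_coe (j := I) le_rfl n)
      · rw [hm, ← hS₀, hn]; rfl
    have := h1 I (Nat.lt_succ_self i)
    rwa [D.projNc_coe] at this
  have hsurj : Function.Surjective S₀ := by
    intro y
    obtain ⟨c, hc, hcy⟩ := (D.projR_eq_zero_iff_conv hL (i := i) (by omega) (y : B')).1
      fun j hj => D.projR_coe_of_ne (i := I) (fun e => by rw [e] at hj; exact lt_irrefl _ hj) y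
    have hb : D.InTail i (c 0) := (D.inTail_iff_conv hL (by omega) _).2 ⟨c, rfl, hc⟩
    have := hdefect (c 0) hb c rfl hc
    rw [hcy, D.projR_coe, hS _ hb, D.projR_coe] at this
    exact ⟨_, this⟩
  have _ : CompleteSpace (D.Nc I) := (D.isClosed_Nc I).completeSpace_coe
  have _ : CompleteSpace (D.R I) := (D.isClosed_R I).completeSpace_coe
  refine ⟨φ', hzero, ?_, ?_, ?_⟩
  · intro l hl b
    rw [hφ']
    refine Submodule.sub_mem _ (D.partialSum_mono (by omega) (h.mem l hl b)) ?_
    refine Submodule.sum_mem _ fun j _ => ?_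
    split_ifs with h1 h2
    -- The range bound is exact: j + 1 - (l - (i - j)) = i + 1 - l.
    · exact D.partialSum_mono (by omega) (h.mem_Nc (l - (i - j)) j ⟨_, hEmem j b⟩)
    · exact Submodule.zero_mem _
    · exact Submodule.zero_mem _
  · intro l j n
    rw [hφ']
    refine Submodule.sub_mem _ (h.mem_Nc l j n) ?_
    refine Submodule.sum_mem _ fun j' _ => ?_
    split_ifs with h1 h2
    · by_cases hj : (j : ℕ) < i
      · rw [hE0 j' _ (by rw [ContinuousLinearMap.comp_apply, hQ0 j hj, map_zero]), map_zero]
        exact Submodule.zero_mem _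
      · exact D.partialSum_mono (by omega) (h.mem_Nc (l - (i - j')) j' ⟨_, hEmem j' n⟩)
    · exact Submodule.zero_mem _
    · exact Submodule.zero_mem _
  · intro j hj
    rcases Nat.lt_succ_iff_lt_or_eq.1 hj with hj | hj
    · obtain ⟨S, hS⟩ := h.iso j hj
      exact ⟨S, fun b hb => by rw [hlow j hj, hS b hb]⟩
    · have : j = I := Fin.ext hj
      subst this
      exact ⟨ContinuousLinearEquiv.ofBijective S₀ (LinearMap.ker_eq_bot.2 hinj)
        (LinearMap.range_eq_top.2 hsurj), hS⟩

/-- Jordan chains exist: `L` is diagonal up to higher order along a near identity family. -/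
theorem nonempty_chainFamily (hL : HasCoeffs L ℓ (k + 1)) : Nonempty (ChainFamily D) := by
  have hstage : ∀ i, i ≤ k + 1 → ∃ φ, D.ChainStage ℓ i φ := by
    intro i
    induction i with
    | zero => exact fun _ => ⟨_, D.chainStage_zero⟩
    | succ i ih =>
      intro hi
      obtain ⟨φ, hφ⟩ := ih (by omega)
      exact hφ.succ hL (by omega)
  obtain ⟨φ, hφ⟩ := hstage (k + 1) le_rfl
  choose S hS using hφ.iso
  have hsum : ∀ (ε : 𝕜) (b : B), (∑ j ∈ Finset.range (k + 1), ε ^ j • φ j) b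
      = ∑ j ∈ Finset.range (k + 1), ε ^ j • φ j b := fun ε b => by
    simp only [sum_apply, smul_apply]
  refine ⟨⟨fun i => S i i.2, φ, hφ.zero, fun i hi _ b => hφ.mem i hi b, ?_, ?_⟩⟩
  · intro i n
    have := (hL.apply_sum_sub_isBigO_iff (l := i + 1) (m := k + 1) (by omega) (by omega)
      (fun l => φ l (n : B)) fun m => if m = i then (S i i.2 n : B') else 0).2 ?_
    · simpa only [sum_pow_smul_ite, hsum] using this
    · intro m hm
      split_ifs with hmi
      · subst hmi
        rw [hS i i.2 _ (D.inTail_coe le_rfl n), D.projNc_coe]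
      · exact hφ.conv_eq_zero (by omega) (m := i) (by omega) i.2.le (D.inTail_coe le_rfl n)
  · intro n
    have := (hL.apply_sum_sub_isBigO_iff (l := k + 1) (m := k + 1) le_rfl le_rfl
      (fun l => φ l (n : B)) fun m => 0).2 ?_
    · simpa only [hsum, smul_zero, Finset.sum_const_zero, sub_zero] using this
    · exact fun m hm => hφ.conv_eq_zero hm hm le_rfl fun j _ => D.projNc_coe_N j n

end JordanSplitting

end Chains
end

/-! ### Contraction principle with smooth parameters -/

section Implicit

variable {𝕜 : Type*} [RCLike 𝕜]
  {P : Type*} [NormedAddCommGroup P] [NormedSpace 𝕜 P] [CompleteSpace P]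
  {X : Type*} [NormedAddCommGroup X] [NormedSpace 𝕜 X] [CompleteSpace X]
  {Y : Type*} [NormedAddCommGroup Y] [NormedSpace 𝕜 Y] [CompleteSpace Y]

/-- Neumann series for T⁻¹A. -/
theorem isInvertible_of_norm_id_sub_lt (T : X ≃L[𝕜] Y) {A : X →L[𝕜] Y}
    (h : ‖ContinuousLinearMap.id 𝕜 X - (T.symm : Y →L[𝕜] X).comp A‖ < 1) : A.IsInvertible := by
  let u : (X →L[𝕜] X)ˣ := Units.oneSub _ h
  refine ⟨(ContinuousLinearEquiv.unitsEquiv 𝕜 X u).trans T, ?_⟩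
  have hu : (u : X →L[𝕜] X) = (T.symm : Y →L[𝕜] X).comp A := by
    rw [Units.val_oneSub]
    exact sub_sub_cancel _ _
  ext x
  have : ContinuousLinearEquiv.unitsEquiv 𝕜 X u x = T.symm (A x) := by
    rw [ContinuousLinearEquiv.unitsEquiv_apply, hu]; rfl
  simp [this]

/-- A family of equations `F (p, x) = 0` for which the modified Newton map is a contraction has
a unique solution, which is as smooth as `F`. -/
theorem exists_contDiffOn_solution {q : WithTop ℕ∞} (hq : q ≠ 0) {F : P × X → Y}
    {O : Set P} (hO : IsOpen O) {V : Set X} (hV : IsOpen V) (hF : ContDiffOn 𝕜 q F (O ×ˢ V))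
    (T : X ≃L[𝕜] Y) {K : Set X} (hK : IsClosed K) (hKV : K ⊆ V) (hne : K.Nonempty)
    (hmap : ∀ p ∈ O, ∀ x ∈ K, x - T.symm (F (p, x)) ∈ K)
    (hlip : ∀ p ∈ O, ∀ x ∈ V, ∀ y ∈ V,
      ‖(x - T.symm (F (p, x))) - (y - T.symm (F (p, y)))‖ ≤ 1 / 2 * ‖x - y‖) :
    ∃ ν : P → X, ContDiffOn 𝕜 q ν O ∧ (∀ p ∈ O, ν p ∈ K ∧ F (p, ν p) = 0) ∧
      ∀ p ∈ O, ∀ x ∈ V, F (p, x) = 0 → x = ν p := by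
  have hlip' : ∀ p ∈ O, LipschitzOnWith (1 / 2) (fun x => x - T.symm (F (p, x))) V := by
    intro p hp
    refine LipschitzOnWith.of_dist_le_mul fun x hx y hy => ?_
    rw [dist_eq_norm, dist_eq_norm]
    simpa using hlip p hp x hx y hy
  have hex : ∀ p ∈ O, ∃ x ∈ K, F (p, x) = 0 := by
    intro p hp
    have hm : Set.MapsTo (fun x => x - T.symm (F (p, x))) K K := hmap p hp
    have hc : ContractingWith (1 / 2) (hm.restrict _ K K) := by
      refine ⟨by norm_num, ?_⟩
      exact ((hlip' p hp).mono hKV).mapsToRestrict hm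
    obtain ⟨x₀, hx₀⟩ := hne
    obtain ⟨x, hx, hfix, -⟩ := ContractingWith.exists_fixedPoint' hK.isComplete hm hc hx₀
      (edist_ne_top _ _)
    refine ⟨x, hx, ?_⟩
    have : T.symm (F (p, x)) = 0 := by
      have := hfix.eq
      simpa using this
    simpa using this
  have huniq : ∀ p ∈ O, ∀ x ∈ V, ∀ y ∈ V, F (p, x) = 0 → F (p, y) = 0 → x = y := by
    intro p hp x hx y hy h1 h2
    have := hlip p hp x hx y hy
    rw [h1, h2, map_zero, sub_zero, sub_zero] at this
    have h3 : ‖x - y‖ = 0 := by linarith [norm_nonneg (x - y)]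
    exact sub_eq_zero.1 (norm_eq_zero.1 h3)
  choose! ν hνK hν0 using hex
  refine ⟨ν, ?_, fun p hp => ⟨hνK p hp, hν0 p hp⟩,
    fun p hp x hx h => huniq p hp x hx _ (hKV (hνK p hp)) h (hν0 p hp)⟩
  intro p hp
  refine ContDiffAt.contDiffWithinAt ?_
  set u : P × X := (p, ν p) with hu
  have hmem : O ×ˢ V ∈ 𝓝 u := (hO.prod hV).mem_nhds ⟨hp, hKV (hνK p hp)⟩
  have hFu : ContDiffAt 𝕜 q F u := hF.contDiffAt hmem
  have hd : HasFDerivAt F (fderiv 𝕜 F u) u := (hFu.differentiableAt hq).hasFDerivAt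
  have hd2 : HasFDerivAt (fun x => F (p, x)) ((fderiv 𝕜 F u).comp (.inr 𝕜 P X)) (ν p) :=
    hd.comp (ν p) (hasFDerivAt_prodMk_right p (ν p))
  have hd3 : HasFDerivAt (fun x => x - T.symm (F (p, x)))
      (ContinuousLinearMap.id 𝕜 X
        - (T.symm : Y →L[𝕜] X).comp ((fderiv 𝕜 F u).comp (.inr 𝕜 P X))) (ν p) :=
    (hasFDerivAt_id _).sub ((T.symm : Y →L[𝕜] X).hasFDerivAt.comp (ν p) hd2)
  -- The Lipschitz constant 1/2 bounds the derivative of the Newton map, so the partial derivative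
  -- of `F` in x is invertible at every solution. By uniqueness in `V`, the local implicit function
  -- coincides with `ν`.
  have hn := norm_fderiv_le_of_lipschitzOn 𝕜 (hV.mem_nhds (hKV (hνK p hp))) (hlip' p hp)
  rw [hd3.fderiv] at hn
  have hinv : ((fderiv 𝕜 F u).comp (.inr 𝕜 P X)).IsInvertible := by
    refine isInvertible_of_norm_id_sub_lt T (hn.trans_lt ?_)
    norm_num
  have hψ := hFu.contDiffAt_implicitFunction hq hinv
  refine hψ.congr_of_eventuallyEq ?_
  have hc : Tendsto (fun p' => hFu.implicitFunction hq hinv p') (𝓝 p) (𝓝 (ν p)) := by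
    have h1 := hψ.continuousAt.tendsto
    have h2 : hFu.implicitFunction hq hinv p = ν p := hFu.implicitFunction_apply_self hq hinv
    change Tendsto _ (𝓝 p) (𝓝 (hFu.implicitFunction hq hinv p)) at h1
    rwa [h2] at h1
  filter_upwards [hO.mem_nhds hp, hc (hV.mem_nhds (hKV (hνK p hp))),
    hFu.eventually_apply_implicitFunction hq hinv] with p' hp' hV' h0
  refine huniq p' hp' _ (hKV (hνK p' hp')) _ hV' (hν0 p' hp') ?_
  rw [h0, hu, hν0 p hp]

end Implicit

/-! ### Convergence in the bounded Lipschitz norm -/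

section Tame

variable {𝕜 : Type*} [RCLike 𝕜]
  {V : Type*} [NormedAddCommGroup V] [NormedSpace 𝕜 V]
  {E : Type*} [NormedAddCommGroup E] [NormedSpace 𝕜 E]
  {F : Type*} [NormedAddCommGroup F] [NormedSpace 𝕜 F]

/-- On the ball of radius `ρ` the map `u` is bounded by `C` and `C`-Lipschitz. -/
def BoundedLipschitz (ρ C : ℝ) (u : V → F) : Prop :=
  ∀ v w, ‖v‖ ≤ ρ → ‖w‖ ≤ ρ → ‖u v‖ ≤ C ∧ ‖u v - u w‖ ≤ C * ‖v - w‖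

namespace BoundedLipschitz

variable {ρ C C' : ℝ}

theorem mono {u : V → F} (h : BoundedLipschitz ρ C u) (hC : C ≤ C') :
    BoundedLipschitz ρ C' u := fun v w hv hw =>
  ⟨(h v w hv hw).1.trans hC,
    (h v w hv hw).2.trans (mul_le_mul_of_nonneg_right hC (norm_nonneg _))⟩

theorem add {u u' : V → F} (h : BoundedLipschitz ρ C u) (h' : BoundedLipschitz ρ C' u') :
    BoundedLipschitz ρ (C + C') fun v => u v + u' v := by
  intro v w hv hw
  refine ⟨(norm_add_le _ _).trans (add_le_add (h v w hv hw).1 (h' v w hv hw).1), ?_⟩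
  rw [add_sub_add_comm, add_mul]
  exact (norm_add_le _ _).trans (add_le_add (h v w hv hw).2 (h' v w hv hw).2)

theorem clm_apply {u : V → E →L[𝕜] F} {g : V → E} (h : BoundedLipschitz ρ C u)
    (h' : BoundedLipschitz ρ C' g) (hC : 0 ≤ C) (hC' : 0 ≤ C') :
    BoundedLipschitz ρ (2 * (C * C')) fun v => u v (g v) := by
  intro v w hv hw
  obtain ⟨h1, h2⟩ := h v w hv hw
  obtain ⟨h3, h4⟩ := h' v w hv hw
  obtain ⟨h5, -⟩ := h w v hw hv
  constructor
  · calc ‖u v (g v)‖ ≤ C * C' := (u v).le_of_opNorm_le_of_le h1 h3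
      _ ≤ 2 * (C * C') := by nlinarith [mul_nonneg hC hC']
  · have e : u v (g v) - u w (g w) = (u v - u w) (g v) + u w (g v - g w) := by
      simp
    rw [e]
    calc ‖(u v - u w) (g v) + u w (g v - g w)‖
        ≤ C * ‖v - w‖ * C' + C * (C' * ‖v - w‖) :=
          (norm_add_le _ _).trans (add_le_add ((u v - u w).le_of_opNorm_le_of_le h2 h3)
            ((u w).le_of_opNorm_le_of_le h5 h4))
      _ = 2 * (C * C') * ‖v - w‖ := by ring

end BoundedLipschitz

/-- As `ε → 0` the maps `f ε` tend to `f 0` in the bounded Lipschitz norm of every ball. -/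
def Tame (f : 𝕜 → V → F) : Prop :=
  ∀ ρ : ℝ, (∃ C, 0 ≤ C ∧ BoundedLipschitz ρ C (f 0)) ∧
    ∀ η > 0, ∀ᶠ ε in 𝓝 (0 : 𝕜), BoundedLipschitz ρ η fun v => f ε v - f 0 v

namespace Tame

theorem add {f g : 𝕜 → V → F} (hf : Tame f) (hg : Tame g) : Tame fun ε v => f ε v + g ε v := by
  intro ρ
  obtain ⟨⟨C, hC, h1⟩, h2⟩ := hf ρ
  obtain ⟨⟨C', hC', h1'⟩, h2'⟩ := hg ρ
  refine ⟨⟨C + C', by positivity, h1.add h1'⟩, fun η hη => ?_⟩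
  filter_upwards [h2 (η / 2) (by positivity), h2' (η / 2) (by positivity)] with ε h3 h4
  have := h3.add h4
  rw [add_halves] at this
  simpa only [add_sub_add_comm] using this

theorem clm_apply {f : 𝕜 → V → E →L[𝕜] F} {g : 𝕜 → V → E} (hf : Tame f) (hg : Tame g) :
    Tame fun ε v => f ε v (g ε v) := by
  intro ρ
  obtain ⟨⟨C, hC, h1⟩, h2⟩ := hf ρ
  obtain ⟨⟨C', hC', h1'⟩, h2'⟩ := hg ρ
  refine ⟨⟨_, by positivity, h1.clm_apply h1' hC hC'⟩, fun η hη => ?_⟩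
  -- The three error terms of the product sum to 2θC' + 2θC + 2θ², which is at most η since θ ≤ 1.
  set θ := min 1 (η / (2 * C + 2 * C' + 2)) with hθ
  have hθ0 : 0 < θ := lt_min one_pos (by positivity)
  filter_upwards [h2 θ hθ0, h2' θ hθ0] with ε h3 h4
  have h5 := ((h3.clm_apply h1' hθ0.le hC').add (h1.clm_apply h4 hC hθ0.le)).add
    (h3.clm_apply h4 hθ0.le hθ0.le)
  have h6 : BoundedLipschitz ρ η fun v => (f ε v - f 0 v) (g 0 v) + f 0 v (g ε v - g 0 v)
      + (f ε v - f 0 v) (g ε v - g 0 v) := by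
    refine h5.mono ?_
    have h7 : θ * (2 * C + 2 * C' + 2) ≤ η := by
      rw [← le_div_iff₀ (by positivity)]
      exact min_le_right _ _
    have h8 : θ ≤ 1 := min_le_left _ _
    nlinarith
  convert h6 using 2 with v
  simp

theorem const {c : 𝕜 → F} (hc : ContinuousAt c 0) : Tame fun ε (_ : V) => c ε := by
  intro ρ
  refine ⟨⟨‖c 0‖, norm_nonneg _, fun v w _ _ => ⟨le_rfl, ?_⟩⟩, fun η hη => ?_⟩
  · simp only [sub_self, norm_zero]
    positivity
  · filter_upwards [Metric.continuousAt_iff'.1 hc η hη] with ε hε v w _ _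
    refine ⟨by rw [← dist_eq_norm]; exact hε.le, ?_⟩
    simp only [sub_self, norm_zero]
    positivity

theorem clm (A : V →L[𝕜] F) : Tame fun (_ : 𝕜) v => A v := by
  intro ρ
  refine ⟨⟨‖A‖ * max ρ 1, by positivity, fun v w hv _ => ⟨?_, ?_⟩⟩, fun η hη => ?_⟩
  · exact A.le_of_opNorm_le_of_le le_rfl (hv.trans (le_max_left _ _))
  · rw [← map_sub]
    refine (A.le_opNorm _).trans (mul_le_mul_of_nonneg_right ?_ (norm_nonneg _))
    exact le_mul_of_one_le_right (norm_nonneg _) (le_max_right _ _)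
  · refine Eventually.of_forall fun ε v w _ _ => ?_
    simp only [sub_self, norm_zero]
    exact ⟨hη.le, by positivity⟩

theorem smul {c : 𝕜 → 𝕜} (hc : ContinuousAt c 0) {f : 𝕜 → V → F} (hf : Tame f) :
    Tame fun ε v => c ε • f ε v := by
  have h := (const (V := V) (c := fun ε => c ε • ContinuousLinearMap.id 𝕜 F)
    (hc.smul continuousAt_const)).clm_apply hf
  exact h

/-- The factor `c ε` shrinks every ball of `V` into a neighbourhood of 0 where `K` is Lipschitz, so
the only information on `K` needed is local. It is used for the cubic remainder. -/
theorem comp_smul {E₁ : Type*} [NormedAddCommGroup E₁] [NormedSpace 𝕜 E₁] {K : E₁ × E → F}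
    (hK : ContDiffAt 𝕜 1 K 0) {z : 𝕜 → E₁} (hz : ContinuousAt z 0) (hz0 : z 0 = 0)
    {c : 𝕜 → 𝕜} (hc : ContinuousAt c 0) (hc0 : c 0 = 0) {g : 𝕜 → V → E} (hg : Tame g) :
    Tame fun ε v => K (z ε, c ε • g ε v) := by
  obtain ⟨C, s, hs, hCs⟩ := hK.exists_lipschitzOnWith
  obtain ⟨d, hd, hds⟩ := Metric.mem_nhds_iff.1 hs
  intro ρ
  refine ⟨⟨‖K 0‖, norm_nonneg _, fun v w _ _ => ?_⟩, fun η hη => ?_⟩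
  · simp only [hc0, hz0, zero_smul, sub_self, norm_zero]
    exact ⟨le_rfl, by positivity⟩
  set θ := min (d / 2) (η / (C + 1)) with hθ
  have hθ0 : 0 < θ := lt_min (by positivity) (by positivity)
  have hθη : C * θ ≤ η := by
    have : θ * (C + 1) ≤ η := by
      rw [← le_div_iff₀ (by positivity)]
      exact min_le_right _ _
    nlinarith
  have hθd : θ < d := (min_le_left _ _).trans_lt (by linarith)
  filter_upwards [Metric.continuousAt_iff'.1 hz θ hθ0, ((hg.smul hc) ρ).2 θ hθ0] with ε h1 h2
  simp only [hc0, hz0, zero_smul, sub_zero, dist_zero_right] at h1 h2 ⊢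
  have hmem : ∀ v, ‖v‖ ≤ ρ → (z ε, c ε • g ε v) ∈ s := fun v hv => by
    refine hds ?_
    rw [mem_ball_zero_iff, Prod.norm_def]
    exact max_lt (h1.trans hθd) ((h2 v v hv hv).1.trans_lt hθd)
  have h0 : ((0 : E₁), (0 : E)) ∈ s := mem_of_mem_nhds hs
  intro v w hv hw
  constructor
  · refine (hCs.norm_sub_le (hmem v hv) h0).trans (le_trans ?_ hθη)
    refine mul_le_mul_of_nonneg_left ?_ C.2
    rw [Prod.norm_def]
    simp only [Prod.mk_sub_mk, sub_zero]
    exact max_le h1.le (h2 v v hv hv).1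
  · rw [sub_sub_sub_cancel_right]
    refine (hCs.norm_sub_le (hmem v hv) (hmem w hw)).trans ?_
    rw [Prod.norm_def]
    simp only [Prod.mk_sub_mk, sub_self, norm_zero, norm_nonneg, sup_of_le_right]
    calc (C : ℝ) * ‖c ε • g ε v - c ε • g ε w‖ ≤ C * (θ * ‖v - w‖) :=
          mul_le_mul_of_nonneg_left (h2 v w hv hw).2 C.2
      _ ≤ η * ‖v - w‖ := by
          rw [← mul_assoc]
          exact mul_le_mul_of_nonneg_right hθη (norm_nonneg _)

end Tame

end Tame

/-! ### Dividing the equation by ε^(2k-1) -/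

section Reduction

variable {𝕜 : Type*} [RCLike 𝕜]
  {B : Type*} [NormedAddCommGroup B] [NormedSpace 𝕜 B]
  {B' : Type*} [NormedAddCommGroup B'] [NormedSpace 𝕜 B'] [CompleteSpace B']
  {V : Type*} [NormedAddCommGroup V] [NormedSpace 𝕜 V]

theorem exists_hasCoeffs (K : ℕ) {L : 𝕜 → B →L[𝕜] B'} {ρ : ℝ} (hρ : 0 < ρ)
    (hL : ContDiffOn 𝕜 ((K : ℕ∞) : WithTop ℕ∞) L (Metric.ball 0 ρ)) :
    ∃ ℓ, HasCoeffs L ℓ K := by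
  obtain ⟨ℓ, g, hg, hLg⟩ := exists_expansion 0 K (f := L) (by rwa [zero_add])
  refine ⟨ℓ, fun l hl => ?_⟩
  obtain ⟨e, rfl⟩ := Nat.exists_eq_add_of_le hl
  have h1 : (fun ε : 𝕜 => (∑ x ∈ Finset.range e, ε ^ (l + x) • ℓ (l + x)) + ε ^ (l + e) • g ε)
      =O[𝓝 0] fun ε : 𝕜 => ε ^ l := by
    have key : ∀ (m : ℕ) (b : 𝕜 → B →L[𝕜] B'), ContinuousAt b 0 →
        (fun ε : 𝕜 => ε ^ (l + m) • b ε) =O[𝓝 0] fun ε : 𝕜 => ε ^ l := fun m b hb => by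
      have := (pow_isBigO_pow (𝕜 := 𝕜) (Nat.le_add_right l m)).smul (hb.isBigO_one 𝕜)
      simpa using this
    exact (IsBigO.fun_sum fun x _ => key x _ continuousAt_const).add
      (key e g (continuousAt_zero_of_contDiffOn hρ hg))
  refine h1.congr' ?_ EventuallyEq.rfl
  filter_upwards [Metric.ball_mem_nhds (0 : 𝕜) hρ] with ε hε
  rw [hLg ε hε, Finset.sum_range_add]
  abel

/-- After division by `ε ^ (2 * k - 1)`, the equation `G = 0` in a cone is regular at `ε = 0`. -/
theorem exists_reduced_equation {k : ℕ} (hk : 3 ≤ k) {q : ℕ∞} (hq : 1 ≤ q) {G : B → B'}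
    (hG : ContDiff 𝕜 ((q + 3 : ℕ∞) : WithTop ℕ∞) G) {ρ : ℝ} (hρ : 0 < ρ) {z : 𝕜 → B}
    (hz : ContDiffOn 𝕜 q z (Metric.ball 0 ρ)) (hz0 : z 0 = 0)
    {β : 𝕜 → B'} (hβ : ContDiffOn 𝕜 q β (Metric.ball 0 ρ))
    (hGz : ∀ ε ∈ Metric.ball (0 : 𝕜) ρ, G (z ε) = ε ^ (2 * k - 1) • β ε)
    {u : V →L[𝕜] B} {w : 𝕜 → V →L[𝕜] B} (hw : ContDiffOn 𝕜 q w (Metric.ball 0 ρ))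
    {A : 𝕜 → V →L[𝕜] B'} (hA : ContDiffOn 𝕜 q A (Metric.ball 0 ρ))
    (hLA : ∀ ε ∈ Metric.ball (0 : 𝕜) ρ, ∀ v,
      linearization G z ε ((u + ε • w ε) v) = ε ^ k • A ε v)
    (hcurv : ContDiffOn 𝕜 q (curvature G z) (Metric.ball 0 ρ))
    {b : 𝕜 → B →L[𝕜] B →L[𝕜] B'} (hb : ContDiffOn 𝕜 q b (Metric.ball 0 ρ))
    (hcb : ∀ ε ∈ Metric.ball (0 : 𝕜) ρ, curvature G z ε = curvature G z 0 + ε • b ε)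
    (hu : ∀ v, curvature G z 0 (u v) (u v) = 0) :
    ∃ F : 𝕜 → V → B', ContDiffOn 𝕜 q (fun x : 𝕜 × V => F x.1 x.2) (Metric.ball 0 ρ ×ˢ Set.univ) ∧
      (∀ ε ∈ Metric.ball (0 : 𝕜) ρ, ∀ v,
        G (z ε + ε ^ (k - 1) • (u + ε • w ε) v) = ε ^ (2 * k - 1) • F ε v) ∧
      Tame F ∧
      ∀ v, F 0 v = β 0 + A 0 v + (b 0 (u v) (u v)
        + (curvature G z 0 (u v) (w 0 v) + curvature G z 0 (w 0 v) (u v))) := by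
  obtain ⟨K, hK, hGK⟩ := exists_taylor_remainder q hG
  have hq' : (1 : WithTop ℕ∞) ≤ (q : WithTop ℕ∞) := by exact_mod_cast hq
  -- The surplus exponent of the cubic term is (3k - 3) - (2k - 1) = k - 2 = m + 1, which is
  -- positive, so that term disappears at ε = 0.
  obtain ⟨m, rfl⟩ : ∃ m, k = m + 3 := ⟨k - 3, by omega⟩
  set C := curvature G z with hC
  let W : 𝕜 → V →L[𝕜] B := fun ε => u + ε • w ε
  let F : 𝕜 → V → B' := fun ε v => β ε + A ε v + (b ε (u v) (u v)
    + (C ε (u v) (w ε v) + C ε (w ε v) (u v) + ε • C ε (w ε v) (w ε v)))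
    + ε ^ (m + 1) • K (z ε, ε ^ (m + 2) • W ε v) (W ε v) (W ε v) (W ε v)
  have cz := continuousAt_zero_of_contDiffOn hρ hz
  have cβ := continuousAt_zero_of_contDiffOn hρ hβ
  have cw := continuousAt_zero_of_contDiffOn hρ hw
  have cA := continuousAt_zero_of_contDiffOn hρ hA
  have cb := continuousAt_zero_of_contDiffOn hρ hb
  have cC := continuousAt_zero_of_contDiffOn hρ hcurv
  have cW : ContinuousAt W 0 := continuousAt_const.add (continuousAt_id.smul cw)
  refine ⟨F, ?_, ?_, ?_, ?_⟩
  · have f1 : ContDiffOn 𝕜 q (fun x : 𝕜 × V => x.1) (Metric.ball 0 ρ ×ˢ Set.univ) :=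
      contDiffOn_fst
    have f2 : ContDiffOn 𝕜 q (fun x : 𝕜 × V => x.2) (Metric.ball 0 ρ ×ˢ Set.univ) :=
      contDiffOn_snd
    have hm : Set.MapsTo (fun x : 𝕜 × V => x.1) (Metric.ball 0 ρ ×ˢ Set.univ)
      (Metric.ball 0 ρ) := fun x hx => hx.1
    have sβ := hβ.comp f1 hm
    have sA := (hA.comp f1 hm).clm_apply f2
    have sw := (hw.comp f1 hm).clm_apply f2
    have su : ContDiffOn 𝕜 q (fun x : 𝕜 × V => u x.2) (Metric.ball 0 ρ ×ˢ Set.univ) :=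
      u.contDiff.comp_contDiffOn f2
    have sb := ((hb.comp f1 hm).clm_apply su).clm_apply su
    have sC := hcurv.comp f1 hm
    have sW : ContDiffOn 𝕜 q (fun x : 𝕜 × V => W x.1 x.2) (Metric.ball 0 ρ ×ˢ Set.univ) :=
      (su.add (f1.smul sw)).congr fun x _ => rfl
    have sK : ContDiffOn 𝕜 q (fun x : 𝕜 × V => K (z x.1, x.1 ^ (m + 2) • W x.1 x.2))
        (Metric.ball 0 ρ ×ˢ Set.univ) :=
      hK.comp_contDiffOn ((hz.comp f1 hm).prodMk ((f1.pow _).smul sW))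
    exact ((sβ.add sA).add (sb.add ((((sC.clm_apply su).clm_apply sw).add
      ((sC.clm_apply sw).clm_apply su)).add (f1.smul ((sC.clm_apply sw).clm_apply sw))))).add
      ((f1.pow _).smul (((sK.clm_apply sW).clm_apply sW).clm_apply sW))
  · intro ε hε v
    have hL := hLA ε hε v
    have e1 : (1 / 2 : 𝕜) • fderiv 𝕜 (fderiv 𝕜 G) (z ε) (ε ^ (m + 2) • W ε v)
        (ε ^ (m + 2) • W ε v) = C ε (ε ^ (m + 2) • W ε v) (ε ^ (m + 2) • W ε v) := rfl
    have e2 : fderiv 𝕜 G (z ε) (ε ^ (m + 2) • W ε v)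
        = ε ^ (m + 2) • ε ^ (m + 3) • A ε v := by
      rw [map_smul]
      exact congrArg _ hL
    have e3 : C ε (W ε v) (W ε v) = ε • (b ε (u v) (u v)
        + (C ε (u v) (w ε v) + C ε (w ε v) (u v) + ε • C ε (w ε v) (w ε v))) := by
      have e4 : W ε v = u v + ε • w ε v := rfl
      -- The vanishing of the curvature on the head of the cone supplies the missing factor ε of the
      -- quadratic term.
      have e5 : C ε (u v) (u v) = ε • b ε (u v) (u v) := by
        rw [hcb ε hε]
        simp [hu]
      rw [e4]
      simp only [map_add, map_smul, add_apply, smul_apply, e5]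
      module
    have i1 : m + 3 - 1 = m + 2 := by omega
    have i2 : 2 * (m + 3) - 1 = 2 * m + 5 := by omega
    rw [i1, i2]
    change G (z ε + ε ^ (m + 2) • W ε v) = _
    rw [hGK, hGz ε hε, e1, e2, i2]
    simp only [map_smul, smul_apply, e3, F]
    module
  · have tu : Tame fun (_ : 𝕜) v => u v := Tame.clm u
    have tw : Tame fun ε v => w ε v := (Tame.const cw).clm_apply (Tame.clm (.id 𝕜 V))
    have tW : Tame fun ε v => W ε v := (Tame.const cW).clm_apply (Tame.clm (.id 𝕜 V))
    have tA : Tame fun ε v => A ε v := (Tame.const cA).clm_apply (Tame.clm (.id 𝕜 V))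
    have tC : Tame fun ε (_ : V) => C ε := Tame.const cC
    have tb := ((Tame.const (V := V) cb).clm_apply tu).clm_apply tu
    have cpow : ∀ j : ℕ, ContinuousAt (fun ε : 𝕜 => ε ^ j) 0 := fun j =>
      (continuous_pow j).continuousAt
    have tK : Tame fun ε v => K (z ε, ε ^ (m + 2) • W ε v) :=
      Tame.comp_smul ((hK.of_le hq').contDiffAt) cz hz0 (cpow _) (by simp) tW
    exact ((Tame.const cβ).add tA).add (tb.add ((((tC.clm_apply tu).clm_apply tw).add
      ((tC.clm_apply tw).clm_apply tu)).add
        (Tame.smul continuousAt_id ((tC.clm_apply tw).clm_apply tw)))) |>.add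
      (Tame.smul (cpow _) (((tK.clm_apply tW).clm_apply tW).clm_apply tW))
  · intro v
    simp only [F, zero_smul, add_zero, ne_eq, Nat.add_eq_zero_iff, one_ne_zero, and_false,
      not_false_eq_true, zero_pow]

end Reduction

/-! ### Solving the triangular system uniformly in ε -/

section Triangular

variable {𝕜 : Type*} [RCLike 𝕜] {ι : Type*} [Fintype ι]
  {X : ι → Type*} [∀ i, NormedAddCommGroup (X i)] [∀ i, NormedSpace 𝕜 (X i)]
  [∀ i, CompleteSpace (X i)]
  {N : Type*} [NormedAddCommGroup N] [NormedSpace 𝕜 N] [CompleteSpace N]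
  {Y : Type*} [NormedAddCommGroup Y] [NormedSpace 𝕜 Y] [CompleteSpace Y]

/-- The equation `F ε (x, m) = 0` where `F 0 (x, m) = T x + E (x, m)` and `E` depends on some
of the components of `x` only, on which it is a small contraction. -/
theorem exists_solution_of_triangular (top : ι → Prop) {q : WithTop ℕ∞} (hq : q ≠ 0) {ρ : ℝ}
    (hρ : 0 < ρ)
    {F : 𝕜 → (∀ i, X i) × N → Y} (hF : ContDiffOn 𝕜 q
      (fun x : 𝕜 × ((∀ i, X i) × N) => F x.1 x.2) (Metric.ball 0 ρ ×ˢ Set.univ))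
    (hT : Tame F) (T : (∀ i, X i) ≃L[𝕜] Y) {E : (∀ i, X i) → N → Y}
    (hE : ∀ x m, F 0 (x, m) = T x + E x m) {r C : ℝ} (hr : 0 < r) (hC : 0 ≤ C)
    (hE_top : ∀ x m, (∀ i, top i → ‖x i‖ ≤ r) → ‖m‖ ≤ r → ∀ i, top i →
      ‖T.symm (E x m) i‖ ≤ r / 4)
    (hE_le : ∀ x m, (∀ i, top i → ‖x i‖ ≤ r) → ‖m‖ ≤ r → ∀ i, ‖T.symm (E x m) i‖ ≤ C)
    (hlip_top : ∀ x y m d, (∀ i, top i → ‖x i‖ ≤ r) → (∀ i, top i → ‖y i‖ ≤ r) → ‖m‖ ≤ r →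
      (∀ i, top i → ‖x i - y i‖ ≤ d) → ∀ i, top i →
      ‖T.symm (E x m) i - T.symm (E y m) i‖ ≤ 1 / 8 * d)
    (hlip : ∀ x y m d, (∀ i, top i → ‖x i‖ ≤ r) → (∀ i, top i → ‖y i‖ ≤ r) → ‖m‖ ≤ r →
      (∀ i, top i → ‖x i - y i‖ ≤ d) → ∀ i, ‖T.symm (E x m) i - T.symm (E y m) i‖ ≤ C * d) :
    ∃ ε₀ > (0 : ℝ), ε₀ ≤ ρ ∧ ∃ ν : 𝕜 × N → ∀ i, X i,
      ContDiffOn 𝕜 q ν (Metric.ball 0 ε₀ ×ˢ Metric.ball 0 r) ∧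
      (∀ (ε : 𝕜) (m : N), ‖ε‖ < ε₀ → ‖m‖ < r →
        (∀ i, top i → ‖ν (ε, m) i‖ < r) ∧ F ε (ν (ε, m), m) = 0) ∧
      ∀ ρ' > (0 : ℝ), ∃ ε₁ > (0 : ℝ), ε₁ ≤ ε₀ ∧ ∀ (ε : 𝕜) (n : ∀ i, X i) (m : N),
        ‖ε‖ < ε₁ → ‖m‖ < r → (∀ i, top i → ‖n i‖ < r) → (∀ i, ¬ top i → ‖n i‖ < ρ') →
        F ε (n, m) = 0 → n = ν (ε, m) := by
  classical
  -- In the coordinates x = W y the lower components of the Newton map are divided by `c`, so their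
  -- Lipschitz constant C in the top variables drops to at most 1/8. The top components keep their
  -- scale.
  set c : ℝ := max 1 (8 * C) with hc
  have hc1 : 1 ≤ c := le_max_left _ _
  have hc0 : 0 < c := one_pos.trans_le hc1
  have hcC : 8 * C ≤ c := le_max_right _ _
  have hc' : (c : 𝕜) ≠ 0 := by exact_mod_cast hc0.ne'
  let s : ι → 𝕜ˣ := fun i => if top i then 1 else Units.mk0 (c : 𝕜) hc'
  let W : (∀ i, X i) ≃L[𝕜] (∀ i, X i) :=
    ContinuousLinearEquiv.piCongrRight fun i => ContinuousLinearEquiv.smulLeft (s i)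
  have hW : ∀ y i, W y i = (s i : 𝕜) • y i := fun y i => rfl
  have hW' : ∀ y i, W.symm y i = ((s i)⁻¹ : 𝕜) • y i := fun y i => by
    have := hW (W.symm y) i
    rw [W.apply_symm_apply] at this
    rw [this, inv_smul_smul₀ (s i).ne_zero]
  have hs_top : ∀ i, top i → (s i : 𝕜) = 1 := fun i hi => by simp [s, hi]
  have hs_low : ∀ i, ¬ top i → (s i : 𝕜) = c := fun i hi => by simp [s, hi]
  have hs_norm : ∀ i, ¬ top i → ‖(s i : 𝕜)‖ = c := fun i hi => by
    rw [hs_low i hi, RCLike.norm_ofReal, abs_of_pos hc0]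
  have hs_le : ∀ i, ‖(s i : 𝕜)‖ ≤ c := fun i => by
    by_cases hi : top i
    · rw [hs_top i hi, norm_one]; exact hc1
    · exact (hs_norm i hi).le
  have hW_top : ∀ y i, top i → W y i = y i := fun y i hi => by rw [hW, hs_top i hi, one_smul]
  have hW_norm : ∀ y, ‖W y‖ ≤ c * ‖y‖ := fun y => by
    refine (pi_norm_le_iff_of_nonneg (by positivity)).2 fun i => ?_
    rw [hW, norm_smul]
    exact mul_le_mul (hs_le i) (norm_le_pi_norm y i) (norm_nonneg _) hc0.le
  let Φ : 𝕜 → N → (∀ i, X i) → ∀ i, X i := fun ε m y => y - (W.trans T).symm (F ε (W y, m))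
  have hΦ : ∀ ε m y, Φ ε m y = -W.symm (T.symm (E (W y) m)
      + T.symm (F ε (W y, m) - F 0 (W y, m))) := by
    intro ε m y
    have : F ε (W y, m) = T (W y) + (E (W y) m + (F ε (W y, m) - F 0 (W y, m))) := by
      rw [hE]; abel
    simp only [Φ, ContinuousLinearEquiv.symm_trans_apply]
    rw [this, map_add, map_add, T.symm_apply_apply, W.symm_apply_apply, map_add]
    rw [← this]
    abel
  -- The radius ρ' of the lower components is arbitrary: the limit system does not depend on them,
  -- and the perturbation is small on any ball once ε is small. One radius gives existence, larger
  -- ones the uniqueness statement.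
  have key : ∀ ρ' : ℝ, 0 < ρ' → ∃ ε₁ > (0 : ℝ), ∀ ε : 𝕜, ‖ε‖ < ε₁ → ∀ m : N, ‖m‖ < r →
      ∀ y, (∀ i, top i → ‖y i‖ ≤ r) → (∀ i, ¬ top i → ‖y i‖ ≤ ρ') →
      (∀ i, ‖Φ ε m y i‖ ≤ if top i then r / 2 else C + 1) ∧
      ∀ y', (∀ i, top i → ‖y' i‖ ≤ r) → (∀ i, ¬ top i → ‖y' i‖ ≤ ρ') →
        ‖Φ ε m y - Φ ε m y'‖ ≤ 1 / 2 * ‖y - y'‖ := by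
    intro ρ' hρ'
    set R : ℝ := c * (r + ρ') with hR
    set τ : ℝ := ‖(T.symm : Y →L[𝕜] ∀ i, X i)‖ with hτ
    have hτ0 : 0 ≤ τ := norm_nonneg _
    have hτle : ∀ y, ‖T.symm y‖ ≤ τ * ‖y‖ := fun y =>
      (T.symm : Y →L[𝕜] ∀ i, X i).le_opNorm y
    -- The three bounds give a perturbation with Lipschitz constant at most 1/4, top components at
    -- most r/4, and lower components at most 1. The constants then add up to 1/8 + 1/4 ≤ 1/2, r/4 +
    -- r/4 = r/2 and C + 1.
    set η : ℝ := min (1 / (4 * (τ + 1) * c)) (min (r / (4 * (τ + 1))) (1 / (τ + 1))) with hη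
    have hη0 : 0 < η := by
      refine lt_min ?_ (lt_min ?_ ?_) <;> positivity
    have hη1 : τ * η * c ≤ 1 / 4 := by
      have : η ≤ 1 / (4 * (τ + 1) * c) := min_le_left _ _
      rw [le_div_iff₀ (by positivity)] at this
      nlinarith [mul_pos hη0 hc0]
    have hη2 : τ * η ≤ r / 4 := by
      have : η ≤ r / (4 * (τ + 1)) := (min_le_right _ _).trans (min_le_left _ _)
      rw [le_div_iff₀ (by positivity)] at this
      nlinarith
    have hη3 : τ * η ≤ 1 := by
      have : η ≤ 1 / (τ + 1) := (min_le_right _ _).trans (min_le_right _ _)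
      rw [le_div_iff₀ (by positivity)] at this
      nlinarith
    obtain ⟨ε₁, hε₁, hball⟩ := Metric.eventually_nhds_iff.1 ((hT R).2 η hη0)
    refine ⟨ε₁, hε₁, fun ε hε m hm => ?_⟩
    have hD := hball (show dist ε 0 < ε₁ by rwa [dist_zero_right])
    have hbound : ∀ y : ∀ i, X i, (∀ i, top i → ‖y i‖ ≤ r) → (∀ i, ¬ top i → ‖y i‖ ≤ ρ') →
        ‖(W y, m)‖ ≤ R := by
      intro y h1 h2
      have hy : ‖y‖ ≤ r + ρ' := (pi_norm_le_iff_of_nonneg (by positivity)).2 fun i => by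
        by_cases hi : top i
        · exact (h1 i hi).trans (by linarith)
        · exact (h2 i hi).trans (by linarith)
      refine max_le ((hW_norm y).trans (mul_le_mul_of_nonneg_left hy hc0.le)) ?_
      change ‖m‖ ≤ c * (r + ρ')
      nlinarith
    have htopW : ∀ y : ∀ i, X i, (∀ i, top i → ‖y i‖ ≤ r) → ∀ i, top i → ‖W y i‖ ≤ r :=
      fun y h1 i hi => by rw [hW_top y i hi]; exact h1 i hi
    intro y h1 h2
    have hyR := hbound y h1 h2
    refine ⟨fun i => ?_, fun y' h1' h2' => ?_⟩
    · have hDy := (hD _ _ hyR hyR).1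
      have h3 : ‖T.symm (F ε (W y, m) - F 0 (W y, m)) i‖ ≤ τ * η :=
        (norm_le_pi_norm _ i).trans ((hτle _).trans (mul_le_mul_of_nonneg_left hDy hτ0))
      rw [hΦ, Pi.neg_apply, norm_neg, hW', Pi.add_apply, norm_smul, norm_inv]
      split_ifs with hi
      · rw [hs_top i hi, norm_one, inv_one, one_mul]
        refine (norm_add_le _ _).trans ?_
        linarith [hE_top _ m (htopW y h1) hm.le i hi]
      · rw [hs_norm i hi]
        refine (mul_le_of_le_one_left (norm_nonneg _) (inv_le_one_of_one_le₀ hc1)).trans ?_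
        refine (norm_add_le _ _).trans ?_
        linarith [hE_le _ m (htopW y h1) hm.le i]
    · have hyR' := hbound y' h1' h2'
      set d := ‖y - y'‖ with hd
      have hd0 : 0 ≤ d := norm_nonneg _
      have hDy := (hD _ _ hyR hyR').2
      have hWd : ‖((W y, m) : (∀ i, X i) × N) - (W y', m)‖ ≤ c * d := by
        rw [Prod.mk_sub_mk, sub_self, Prod.norm_def, norm_zero,
          max_eq_left (norm_nonneg _), ← map_sub]
        exact hW_norm _
      have h3 : ∀ i, ‖T.symm (F ε (W y, m) - F 0 (W y, m)) i
          - T.symm (F ε (W y', m) - F 0 (W y', m)) i‖ ≤ 1 / 4 * d := fun i => by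
        rw [← Pi.sub_apply, ← map_sub]
        refine (norm_le_pi_norm _ i).trans ((hτle _).trans ?_)
        calc τ * ‖(F ε (W y, m) - F 0 (W y, m)) - (F ε (W y', m) - F 0 (W y', m))‖
            ≤ τ * (η * (c * d)) := mul_le_mul_of_nonneg_left
              (hDy.trans (mul_le_mul_of_nonneg_left hWd hη0.le)) hτ0
          _ = τ * η * c * d := by ring
          _ ≤ 1 / 4 * d := mul_le_mul_of_nonneg_right hη1 hd0
      have htd : ∀ i, top i → ‖W y i - W y' i‖ ≤ d := fun i hi => by
        rw [hW_top y i hi, hW_top y' i hi]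
        exact norm_le_pi_norm (y - y') i
      refine (pi_norm_le_iff_of_nonneg (by positivity)).2 fun i => ?_
      have e : (Φ ε m y - Φ ε m y') i = -(((s i)⁻¹ : 𝕜) •
          ((T.symm (E (W y) m) i - T.symm (E (W y') m) i)
            + (T.symm (F ε (W y, m) - F 0 (W y, m)) i
              - T.symm (F ε (W y', m) - F 0 (W y', m)) i))) := by
        rw [Pi.sub_apply, hΦ, hΦ, Pi.neg_apply, Pi.neg_apply, hW', hW', Pi.add_apply,
          Pi.add_apply]
        module
      rw [e, norm_neg, norm_smul, norm_inv]
      by_cases hi : top i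
      · rw [hs_top i hi, norm_one, inv_one, one_mul]
        refine (norm_add_le _ _).trans ?_
        linarith [h3 i, hlip_top _ _ m d (htopW y h1) (htopW y' h1') hm.le htd i hi]
      · rw [hs_norm i hi, inv_mul_le_iff₀ hc0]
        refine (norm_add_le _ _).trans ?_
        have h4 := hlip _ _ m d (htopW y h1) (htopW y' h1') hm.le htd i
        have h5 : 8 * C * d ≤ c * d := mul_le_mul_of_nonneg_right hcC hd0
        have h6 : d ≤ c * d := le_mul_of_one_le_left hd0 hc1
        linarith [h3 i]
  obtain ⟨ε₂, hε₂, hkey⟩ := key (C + 2) (by positivity)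
  set ε₀ := min ε₂ ρ with hε₀
  have hε₀0 : 0 < ε₀ := lt_min hε₂ hρ
  set V : Set (∀ i, X i) := Set.univ.pi fun i => Metric.ball 0 (if top i then r else C + 2)
    with hV
  set K : Set (∀ i, X i) :=
    Set.univ.pi fun i => Metric.closedBall 0 (if top i then r / 2 else C + 1) with hK
  have hmemV : ∀ y, y ∈ V → (∀ i, top i → ‖y i‖ < r) ∧ ∀ i, ¬ top i → ‖y i‖ < C + 2 := by
    intro y hy
    refine ⟨fun i hi => ?_, fun i hi => ?_⟩ <;> simpa [hi] using hy i trivial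
  have hmemK : ∀ y, y ∈ K ↔ ∀ i, ‖y i‖ ≤ if top i then r / 2 else C + 1 := by
    intro y
    simp [hK, Set.mem_pi]
  have hKV : K ⊆ V := by
    intro y hy i _
    have := (hmemK y).1 hy i
    rw [mem_ball_zero_iff]
    refine this.trans_lt ?_
    split_ifs <;> linarith
  have hO : IsOpen (Metric.ball (0 : 𝕜) ε₀ ×ˢ Metric.ball (0 : N) r) :=
    Metric.isOpen_ball.prod Metric.isOpen_ball
  have hFs : ContDiffOn 𝕜 q (fun x : (𝕜 × N) × (∀ i, X i) => F x.1.1 (W x.2, x.1.2))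
      ((Metric.ball (0 : 𝕜) ε₀ ×ˢ Metric.ball (0 : N) r) ×ˢ V) := by
    have h1 : ContDiff 𝕜 q (fun x : (𝕜 × N) × (∀ i, X i) => (x.1.1, (W x.2, x.1.2))) :=
      (contDiff_fst.comp contDiff_fst).prodMk
        ((W.contDiff.comp contDiff_snd).prodMk (contDiff_snd.comp contDiff_fst))
    refine hF.comp (t := Metric.ball 0 ρ ×ˢ Set.univ) h1.contDiffOn fun x hx => ⟨?_, trivial⟩
    exact Metric.ball_subset_ball (min_le_right _ _) hx.1.1
  obtain ⟨ν, hν, hν0, hνu⟩ := exists_contDiffOn_solution hq hO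
    (isOpen_set_pi Set.finite_univ fun i _ => Metric.isOpen_ball) hFs (W.trans T)
    (isClosed_set_pi fun i _ => Metric.isClosed_closedBall) hKV ⟨0, by
      rw [hmemK]
      intro i
      rw [Pi.zero_apply, norm_zero]
      split_ifs <;> positivity⟩
    (by
      rintro ⟨ε, m⟩ ⟨h1, h2⟩ y hy
      rw [mem_ball_zero_iff] at h1 h2
      obtain ⟨h3, h4⟩ := hmemV y (hKV hy)
      rw [hmemK]
      exact (hkey ε (h1.trans_le (min_le_left _ _)) m h2 y (fun i hi => (h3 i hi).le)
        fun i hi => (h4 i hi).le).1)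
    (by
      rintro ⟨ε, m⟩ ⟨h1, h2⟩ y hy y' hy'
      rw [mem_ball_zero_iff] at h1 h2
      obtain ⟨h3, h4⟩ := hmemV y hy
      obtain ⟨h3', h4'⟩ := hmemV y' hy'
      exact (hkey ε (h1.trans_le (min_le_left _ _)) m h2 y (fun i hi => (h3 i hi).le)
        fun i hi => (h4 i hi).le).2 y' (fun i hi => (h3' i hi).le) fun i hi => (h4' i hi).le)
  have hmem : ∀ (ε : 𝕜) (m : N), ‖ε‖ < ε₀ → ‖m‖ < r →
      (ε, m) ∈ Metric.ball (0 : 𝕜) ε₀ ×ˢ Metric.ball (0 : N) r := fun ε m h1 h2 =>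
    ⟨mem_ball_zero_iff.2 h1, mem_ball_zero_iff.2 h2⟩
  refine ⟨ε₀, hε₀0, min_le_right _ _, fun x => W (ν x), W.contDiff.comp_contDiffOn hν, ?_, ?_⟩
  · intro ε m h1 h2
    obtain ⟨h3, h4⟩ := hν0 _ (hmem ε m h1 h2)
    refine ⟨fun i hi => ?_, h4⟩
    beta_reduce
    rw [hW_top _ i hi]
    exact (hmemV _ (hKV h3)).1 i hi
  · intro ρ' hρ'
    -- This radius accommodates both the given solution and `ν`; two fixed points of a contraction
    -- coincide.
    obtain ⟨ε₁, hε₁, hkey'⟩ := key (max ρ' (C + 2)) (lt_max_of_lt_left hρ')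
    refine ⟨min ε₁ ε₀, lt_min hε₁ hε₀0, min_le_right _ _, fun ε n m h1 h2 h3 h4 h5 => ?_⟩
    obtain ⟨h6, h7⟩ := hν0 _ (hmem ε m (h1.trans_le (min_le_right _ _)) h2)
    obtain ⟨h8, h9⟩ := hmemV _ (hKV h6)
    have hlow : ∀ i, ¬ top i → ‖W.symm n i‖ ≤ max ρ' (C + 2) := fun i hi => by
      rw [hW', norm_smul, norm_inv, hs_norm i hi]
      exact (mul_le_of_le_one_left (norm_nonneg _) (inv_le_one_of_one_le₀ hc1)).trans
        ((h4 i hi).le.trans (le_max_left _ _))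
    have htop : ∀ i, top i → ‖W.symm n i‖ ≤ r := fun i hi => by
      rw [hW', hs_top i hi, inv_one, one_smul]
      exact (h3 i hi).le
    have := (hkey' ε (h1.trans_le (min_le_left _ _)) m h2 (W.symm n) htop hlow).2 (ν (ε, m))
      (fun i hi => (h8 i hi).le) fun i hi => (h9 i hi).le.trans (le_max_right _ _)
    have e1 : Φ ε m (W.symm n) = W.symm n := by
      simp only [Φ, W.apply_symm_apply, h5, map_zero, sub_zero]
    have e2 : Φ ε m (ν (ε, m)) = ν (ε, m) := by
      simp only [Φ]
      rw [h7, map_zero, sub_zero]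
    rw [e1, e2] at this
    have h10 : ‖W.symm n - ν (ε, m)‖ = 0 := by linarith [norm_nonneg (W.symm n - ν (ε, m))]
    rw [norm_eq_zero, sub_eq_zero] at h10
    beta_reduce
    rw [← h10, W.apply_symm_apply]

end Triangular

/-! ### Derivatives available along the curve -/

section Smoothness

variable {𝕜 : Type*} [RCLike 𝕜]
  {B : Type*} [NormedAddCommGroup B] [NormedSpace 𝕜 B]
  {B' : Type*} [NormedAddCommGroup B'] [NormedSpace 𝕜 B']

theorem coe_add_le_coe_add (q : ℕ∞) {a k : ℕ} (h : a ≤ 2 * k) :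
    ((q + a : ℕ∞) : WithTop ℕ∞) ≤ ((q + 2 * k : ℕ∞) : WithTop ℕ∞) := by
  have : (a : ℕ∞) ≤ 2 * k := by exact_mod_cast h
  exact_mod_cast add_le_add_right this q

theorem contDiffOn_linearization {q : ℕ∞} {k a : ℕ} (ha : a + 1 ≤ 2 * k) {G : B → B'}
    (hG : ContDiff 𝕜 ((q + 2 * k : ℕ∞) : WithTop ℕ∞) G) {s : Set 𝕜} {z : 𝕜 → B}
    (hz : ContDiffOn 𝕜 ((q + 2 * k : ℕ∞) : WithTop ℕ∞) z s) :
    ContDiffOn 𝕜 ((q + a : ℕ∞) : WithTop ℕ∞) (linearization G z) s := by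
  have h1 : ContDiff 𝕜 ((q + a : ℕ∞) : WithTop ℕ∞) (fderiv 𝕜 G) := by
    refine hG.fderiv_right (le_trans ?_ (coe_add_le_coe_add q ha))
    rw [Nat.cast_add, ← add_assoc]
    norm_cast
  exact h1.comp_contDiffOn (hz.of_le (coe_add_le_coe_add q (by omega)))

theorem contDiffOn_curvature {q : ℕ∞} {k a : ℕ} (ha : a + 2 ≤ 2 * k) {G : B → B'}
    (hG : ContDiff 𝕜 ((q + 2 * k : ℕ∞) : WithTop ℕ∞) G) {s : Set 𝕜} {z : 𝕜 → B}
    (hz : ContDiffOn 𝕜 ((q + 2 * k : ℕ∞) : WithTop ℕ∞) z s) :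
    ContDiffOn 𝕜 ((q + a : ℕ∞) : WithTop ℕ∞) (curvature G z) s := by
  have h1 : ContDiff 𝕜 ((q + (a + 1 : ℕ) : ℕ∞) : WithTop ℕ∞) (fderiv 𝕜 G) := by
    refine hG.fderiv_right (le_trans ?_ (coe_add_le_coe_add q ha))
    rw [show a + 2 = a + 1 + 1 by rfl, Nat.cast_add (a + 1), ← add_assoc]
    norm_cast
  have h2 : ContDiff 𝕜 ((q + a : ℕ∞) : WithTop ℕ∞) (fderiv 𝕜 (fderiv 𝕜 G)) := by
    refine h1.fderiv_right ?_
    rw [Nat.cast_add, ← add_assoc]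
    norm_cast
  exact (h2.comp_contDiffOn (hz.of_le (coe_add_le_coe_add q (by omega)))).const_smul (1 / 2 : 𝕜)

end Smoothness

/-! ### The reduced equation of the cone -/

section Chains

variable {𝕜 : Type*} [RCLike 𝕜]
  {B : Type*} [NormedAddCommGroup B] [NormedSpace 𝕜 B] [CompleteSpace B]
  {B' : Type*} [NormedAddCommGroup B'] [NormedSpace 𝕜 B'] [CompleteSpace B']

theorem nonempty_chainFamily_of_contDiff {k : ℕ} (hk : 3 ≤ k) {q : ℕ∞} {G : B → B'}
    (hG : ContDiff 𝕜 ((q + 2 * k : ℕ∞) : WithTop ℕ∞) G) {ρ : ℝ} (hρ : 0 < ρ) {z : 𝕜 → B}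
    (hz : ContDiffOn 𝕜 ((q + 2 * k : ℕ∞) : WithTop ℕ∞) z (Metric.ball 0 ρ))
    (D : JordanSplitting (linearization G z) k) : Nonempty (ChainFamily D) := by
  have h := contDiffOn_linearization (a := k + 1) (by omega) hG hz
  obtain ⟨ℓ, hℓ⟩ := exists_hasCoeffs (k + 1) hρ (h.of_le (by
    exact_mod_cast (le_add_self : ((k + 1 : ℕ) : ℕ∞) ≤ q + (k + 1 : ℕ))))
  exact D.nonempty_chainFamily hℓ

namespace ChainFamily

variable {L : 𝕜 → B →L[𝕜] B'} {k : ℕ} {D : JordanSplitting L k} (C : ChainFamily D)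

/-- The kernel part `nₖ₊₁ᶜ + nₖ₊₁` of the leading term of the cone. -/
noncomputable def coneHead (D : JordanSplitting L k) : ((∀ i, D.Nc i) × D.N) →L[𝕜] B :=
  (D.Nc (Fin.last k)).subtypeL.comp ((ContinuousLinearMap.proj (R := 𝕜)
    (φ := fun i => D.Nc i) (Fin.last k)).comp (.fst 𝕜 _ _)) + D.N.subtypeL.comp (.snd 𝕜 _ _)

theorem coneHead_apply (x : ∀ i, D.Nc i) (m : D.N) :
    coneHead D (x, m) = (x (Fin.last k) : B) + m := rfl

/-- The terms `εᵏ⁻¹ n₁ᶜ + ⋯ + nₖᶜ` of the cone. -/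
noncomputable def coneTail (D : JordanSplitting L k) (ε : 𝕜) : ((∀ i, D.Nc i) × D.N) →L[𝕜] B :=
  ∑ i : Fin k, ε ^ (k - 1 - (i : ℕ)) • (D.Nc i.castSucc).subtypeL.comp
    ((ContinuousLinearMap.proj (R := 𝕜) (φ := fun i => D.Nc i) i.castSucc).comp (.fst 𝕜 _ _))

theorem coneTail_apply (ε : 𝕜) (x : ∀ i, D.Nc i) (m : D.N) :
    coneTail D ε (x, m) = ∑ i : Fin k, ε ^ (k - 1 - (i : ℕ)) • (x i.castSucc : B) := by
  simp only [coneTail, sum_apply, smul_apply]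
  rfl

theorem cone_eq (ε : 𝕜) (x : ∀ i, D.Nc i) (m : D.N) :
    (∑ i : Fin (k + 1), ε ^ (k - (i : ℕ)) • (x i : B)) + (m : B)
      = coneHead D (x, m) + ε • coneTail D ε (x, m) := by
  rw [coneHead_apply, coneTail_apply, Fin.sum_univ_castSucc, Finset.smul_sum]
  simp only [Fin.val_castSucc, Fin.val_last, Nat.sub_self, pow_zero, one_smul, smul_smul]
  have : ∀ i : Fin k, ε * ε ^ (k - 1 - (i : ℕ)) = ε ^ (k - (i : ℕ)) := fun i => by
    rw [← pow_succ']
    congr 1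
    omega
  simp only [this]
  abel

/-- The quotient `(pₖ(ε) - I) / ε`. -/
noncomputable def pTail (ε : 𝕜) : B →L[𝕜] B := ∑ j ∈ Finset.range k, ε ^ j • C.φ (j + 1)

theorem p_eq (ε : 𝕜) : C.p ε = ContinuousLinearMap.id 𝕜 B + ε • C.pTail ε := by
  rw [p, pTail, Finset.sum_range_succ', C.φ_zero, pow_zero, one_smul, Finset.smul_sum, add_comm]
  simp only [smul_smul, pow_succ']

/-- The terms of the cone after the leading one, divided by `ε`. -/
noncomputable def conePart (ε : 𝕜) : ((∀ i, D.Nc i) × D.N) →L[𝕜] B :=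
  (C.pTail ε).comp (coneHead D) + (C.p ε).comp (coneTail D ε)

theorem conePoint_eq (z : 𝕜 → B) (ε : 𝕜) (x : ∀ i, D.Nc i) (m : D.N) :
    C.conePoint z ε x m
      = z ε + ε ^ (k - 1) • (coneHead D + ε • C.conePart ε) (x, m) := by
  rw [conePoint, cone_eq]
  congr 2
  simp only [conePart, p_eq, add_apply, smul_apply, ContinuousLinearMap.comp_apply, map_add,
    map_smul, ContinuousLinearMap.id_apply, smul_add]
  abel

theorem contDiff_sum_pow_smul {n : WithTop ℕ∞} {E : Type*} [NormedAddCommGroup E]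
    [NormedSpace 𝕜 E] {ι : Type*} (s : Finset ι) (e : ι → ℕ) (c : ι → E) :
    ContDiff 𝕜 n fun ε : 𝕜 => ∑ i ∈ s, ε ^ e i • c i :=
  ContDiff.sum fun i _ => (contDiff_id.pow (e i)).smul contDiff_const

theorem contDiff_p {n : WithTop ℕ∞} : ContDiff 𝕜 n C.p :=
  contDiff_sum_pow_smul _ (fun j => j) C.φ

theorem contDiff_conePart {n : WithTop ℕ∞} : ContDiff 𝕜 n C.conePart :=
  ((contDiff_sum_pow_smul _ (fun j => j) fun j => C.φ (j + 1)).clm_comp contDiff_const).add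
    (C.contDiff_p.clm_comp (contDiff_sum_pow_smul _ _ _))

/-- At ε = 0 only `φ 1` on the head and the component of rank k - 1 survive. This makes the limit
equation triangular, and explains why the constants involve no other coefficient of pₖ. -/
theorem conePart_zero {l : Fin (k + 1)} (hl : (l : ℕ) + 1 = k) (x : ∀ i, D.Nc i) (m : D.N) :
    C.conePart 0 (x, m) = C.φ 1 (x (Fin.last k) + m : B) + (x l : B) := by
  have h1 : C.pTail 0 = C.φ 1 := by
    rw [pTail, Finset.sum_eq_single 0]
    · simp
    · intro j _ hj; simp [hj]
    · intro h; exact absurd (Finset.mem_range.2 (by omega)) h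
  have h2 : coneTail D 0 (x, m) = (x l : B) := by
    obtain ⟨j, rfl⟩ : ∃ j : Fin k, j.castSucc = l := ⟨⟨l, by omega⟩, rfl⟩
    rw [Fin.val_castSucc] at hl
    rw [coneTail_apply, Finset.sum_eq_single j]
    · rw [show k - 1 - (j : ℕ) = 0 by omega, pow_zero, one_smul]
    · intro i _ hi
      have : k - 1 - (i : ℕ) ≠ 0 := fun h => hi (Fin.ext (by omega))
      rw [zero_pow this, zero_smul]
    · simp
  rw [conePart, add_apply, ContinuousLinearMap.comp_apply, ContinuousLinearMap.comp_apply, h1, h2,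
    p_eq, zero_smul, add_zero, coneHead_apply]
  rfl

/-- The isomorphism of `N₁ᶜ × ⋯ × Nₖ₊₁ᶜ` to `B'` with the diagonal `S₁, …, Sₖ₊₁`. -/
noncomputable def diagEquiv : (∀ i, D.Nc i) ≃L[𝕜] B' :=
  (ContinuousLinearEquiv.piCongrRight C.S).trans (sumEquiv D.isClosed_R D.isInternal_R)

theorem diagEquiv_apply (x : ∀ i, D.Nc i) : C.diagEquiv x = ∑ i, (C.S i (x i) : B') :=
  sumEquiv_apply D.isClosed_R D.isInternal_R _

/-- On `Nc i` the factor ε^i from the chain and the weight ε^(k-i) of the cone combine to ε^k, with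
limit Sᵢ₊₁. On `N` the order k + 1 exceeds k, so the limit is 0. -/
theorem exists_diagonal_form {q : ℕ∞} {ρ : ℝ} (hρ : 0 < ρ)
    (hL : ContDiffOn 𝕜 ((q + k : ℕ∞) : WithTop ℕ∞) L (Metric.ball 0 ρ)) :
    ∃ A : 𝕜 → ((∀ i, D.Nc i) × D.N) →L[𝕜] B', ContDiffOn 𝕜 q A (Metric.ball 0 ρ) ∧
      (∀ ε ∈ Metric.ball (0 : 𝕜) ρ, ∀ v,
        L ε ((coneHead D + ε • C.conePart ε) v) = ε ^ k • A ε v) ∧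
      ∀ x m, A 0 (x, m) = C.diagEquiv x := by
  have hLp : ContDiffOn 𝕜 ((q + k : ℕ∞) : WithTop ℕ∞) (fun ε => (L ε).comp (C.p ε))
      (Metric.ball 0 ρ) := hL.clm_comp C.contDiff_p.contDiffOn
  have h1 : ∀ i : Fin (k + 1), ∃ g : 𝕜 → D.Nc i →L[𝕜] B', ContDiffOn 𝕜 q g (Metric.ball 0 ρ) ∧
      (∀ ε ∈ Metric.ball (0 : 𝕜) ρ,
        ((L ε).comp (C.p ε)).comp (D.Nc i).subtypeL = ε ^ (i : ℕ) • g ε) ∧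
      g 0 = (D.R i).subtypeL.comp (C.S i : D.Nc i →L[𝕜] D.R i) := fun i => by
    refine exists_eq_pow_smul_clm q i hρ ?_ fun n => C.chain_Nc i n
    have hi : ((q + (i : ℕ) : ℕ∞) : WithTop ℕ∞) ≤ ((q + k : ℕ∞) : WithTop ℕ∞) := by
      have : ((i : ℕ) : ℕ∞) ≤ k := by exact_mod_cast Nat.lt_succ_iff.1 i.2
      exact_mod_cast add_le_add_right this q
    exact (hLp.of_le hi).clm_comp contDiffOn_const
  obtain ⟨gN, hgN, hgN', hgN0⟩ : ∃ g : 𝕜 → D.N →L[𝕜] B', ContDiffOn 𝕜 q g (Metric.ball 0 ρ) ∧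
      (∀ ε ∈ Metric.ball (0 : 𝕜) ρ, ((L ε).comp (C.p ε)).comp D.N.subtypeL = ε ^ k • g ε) ∧
      g 0 = 0 := by
    refine exists_eq_pow_smul_clm q k hρ (hLp.clm_comp contDiffOn_const) fun n => ?_
    simp only [zero_apply, smul_zero, sub_zero]
    exact C.chain_N n
  choose g hg hg' hg0 using h1
  refine ⟨fun ε => (∑ i, (g i ε).comp ((ContinuousLinearMap.proj (R := 𝕜)
    (φ := fun i => D.Nc i) i).comp (.fst 𝕜 _ _))) + (gN ε).comp (.snd 𝕜 _ _), ?_, ?_, ?_⟩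
  · exact (ContDiffOn.sum fun i _ => (hg i).clm_comp contDiffOn_const).add
      (hgN.clm_comp contDiffOn_const)
  · rintro ε hε ⟨x, m⟩
    have e1 : (coneHead D + ε • C.conePart ε) (x, m)
        = C.p ε ((∑ i : Fin (k + 1), ε ^ (k - (i : ℕ)) • (x i : B)) + (m : B)) := by
      rw [cone_eq]
      simp only [conePart, p_eq, add_apply, smul_apply, ContinuousLinearMap.comp_apply, map_add,
        map_smul, ContinuousLinearMap.id_apply, smul_add]
      abel
    have e2 : ∀ i (n : D.Nc i), L ε (C.p ε (n : B)) = ε ^ (i : ℕ) • g i ε n := fun i n =>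
      congrArg (fun T : D.Nc i →L[𝕜] B' => T n) (hg' i ε hε)
    have e3 : L ε (C.p ε (m : B)) = ε ^ k • gN ε m :=
      congrArg (fun T : D.N →L[𝕜] B' => T m) (hgN' ε hε)
    rw [e1, map_add, map_add, e3, map_sum, map_sum, add_apply, smul_add, sum_apply,
      Finset.smul_sum]
    congr 1
    refine Finset.sum_congr rfl fun i _ => ?_
    rw [map_smul, map_smul, e2, smul_smul, ← pow_add, Nat.sub_add_cancel (by omega)]
    rfl
  · intro x m
    rw [add_apply, sum_apply, hgN0, diagEquiv_apply]
    simp only [hg0]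
    change _ + (0 : B') = _
    rw [add_zero]
    rfl

end ChainFamily

/-- The quadratic part of the reduced equation at `ε = 0`. -/
noncomputable def quadPart (b₀ b₁ : B →L[𝕜] B →L[𝕜] B') (a w : B) : B' :=
  b₁ a a + (b₀ a w + b₀ w a)

theorem ChainFamily.exists_reduced_equation {k : ℕ} (hk : 3 ≤ k)
    {l : Fin (k + 1)} (hl : (l : ℕ) + 1 = k) {q : ℕ∞} (hq : 1 ≤ q) {G : B → B'}
    (hG : ContDiff 𝕜 ((q + 2 * k : ℕ∞) : WithTop ℕ∞) G) {ρ : ℝ} (hρ : 0 < ρ) {z : 𝕜 → B}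
    (hz : ContDiffOn 𝕜 ((q + 2 * k : ℕ∞) : WithTop ℕ∞) z (Metric.ball 0 ρ)) (hz0 : z 0 = 0)
    {D : JordanSplitting (linearization G z) k} (C : ChainFamily D)
    {bbar : 𝕜 → B'} (hbbar : ContinuousAt bbar 0)
    (hGz : ∀ ε ∈ Metric.ball (0 : 𝕜) ρ, G (z ε) = ε ^ (2 * k - 1) • bbar ε)
    (hcurv : ∀ u ∈ D.Nc (Fin.last k), ∀ m ∈ D.N, curvature G z 0 (u + m) (u + m) = 0) :
    ∃ F : 𝕜 → (∀ i, D.Nc i) × D.N → B',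
      ContDiffOn 𝕜 q (fun x : 𝕜 × ((∀ i, D.Nc i) × D.N) => F x.1 x.2)
        (Metric.ball 0 ρ ×ˢ Set.univ) ∧
      (∀ ε ∈ Metric.ball (0 : 𝕜) ρ, ∀ x m,
        G (C.conePoint z ε x m) = ε ^ (2 * k - 1) • F ε (x, m)) ∧
      Tame F ∧
      ∀ x m, F 0 (x, m) = C.diagEquiv x + (bbar 0
        + quadPart (curvature G z 0) (deriv (curvature G z) 0) (x (Fin.last k) + m : B)
          (C.φ 1 (x (Fin.last k) + m : B) + (x l : B))) := by
  have hz' : ContDiffOn 𝕜 q z (Metric.ball 0 ρ) :=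
    hz.of_le (by exact_mod_cast (le_self_add : q ≤ q + 2 * k))
  have hGz' : ContDiffOn 𝕜 ((q + (2 * k - 1 : ℕ) : ℕ∞) : WithTop ℕ∞) (fun ε => G (z ε))
      (Metric.ball 0 ρ) :=
    (hG.comp_contDiffOn hz).of_le (coe_add_le_coe_add q (by omega))
  -- `bbar` is only continuous at 0; it is replaced by a smooth quotient with the same value there.
  obtain ⟨β, hβ, hβ', hβ0⟩ := exists_eq_pow_smul q (2 * k - 1) hρ hGz' (s := bbar 0) (by
    have h1 : (fun ε : 𝕜 => ε ^ (2 * k - 1) • (bbar ε - bbar 0)) =o[𝓝 0]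
        fun ε : 𝕜 => ε ^ (2 * k - 1) := by
      have h2 : (fun ε : 𝕜 => bbar ε - bbar 0) =o[𝓝 0] fun _ : 𝕜 => (1 : 𝕜) := by
        rw [isLittleO_one_iff]
        simpa using hbbar.tendsto.sub_const (bbar 0)
      simpa using (isBigO_refl (fun ε : 𝕜 => ε ^ (2 * k - 1)) (𝓝 0)).smul_isLittleO h2
    refine h1.congr' ?_ EventuallyEq.rfl
    filter_upwards [Metric.ball_mem_nhds (0 : 𝕜) hρ] with ε hε
    rw [hGz ε hε, smul_sub])
  have hc := contDiffOn_curvature (a := 1) (by omega) hG hz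
  obtain ⟨b, hb, hb'⟩ := exists_eq_add_smul q hc
  have hb0 : deriv (curvature G z) 0 = b 0 :=
    (hasDerivAt_of_eq_add_smul (continuousAt_zero_of_contDiffOn hρ hb)
      (by filter_upwards [Metric.ball_mem_nhds (0 : 𝕜) hρ] with ε hε using hb' ε hε)).deriv
  obtain ⟨A, hA, hA', hA0⟩ := C.exists_diagonal_form hρ
    (contDiffOn_linearization (a := k) (by omega) hG hz)
  obtain ⟨F, hF, hF', hT, hF0⟩ := JordanCone.exists_reduced_equation hk hq
    (hG.of_le (coe_add_le_coe_add q (a := 3) (by omega))) hρ hz' hz0 hβ hβ'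
    C.contDiff_conePart.contDiffOn hA hA'
    (hc.of_le (by exact_mod_cast (le_self_add : q ≤ q + 1))) hb hb'
    fun v => hcurv _ (v.1 _).2 _ v.2.2
  refine ⟨F, hF, fun ε hε x m => ?_, hT, fun x m => ?_⟩
  · rw [C.conePoint_eq, hF' ε hε]
  · rw [hF0, hA0, C.conePart_zero hl, hβ0, hb0, coneHead_apply, quadPart]
    abel

theorem norm_quadPart_le {b₀ b₁ : B →L[𝕜] B →L[𝕜] B'} {M α ω : ℝ} (h₀ : ‖b₀‖ ≤ M) (h₁ : ‖b₁‖ ≤ M)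
    {a w : B} (ha : ‖a‖ ≤ α) (hw : ‖w‖ ≤ ω) :
    ‖quadPart b₀ b₁ a w‖ ≤ M * α * α + 2 * (M * α * ω) := by
  have i1 := b₁.le_of_opNorm₂_le_of_le h₁ ha ha
  have i2 := b₀.le_of_opNorm₂_le_of_le h₀ ha hw
  have i3 := b₀.le_of_opNorm₂_le_of_le h₀ hw ha
  have h1 := norm_add_le (b₁ a a) (b₀ a w + b₀ w a)
  have h2 := norm_add_le (b₀ a w) (b₀ w a)
  unfold quadPart
  linarith

theorem norm_quadPart_sub_le {b₀ b₁ : B →L[𝕜] B →L[𝕜] B'} {M α ω d e : ℝ} (h₀ : ‖b₀‖ ≤ M)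
    (h₁ : ‖b₁‖ ≤ M) {a w a' w' : B} (ha : ‖a‖ ≤ α) (hw : ‖w‖ ≤ ω) (ha' : ‖a'‖ ≤ α)
    (hw' : ‖w'‖ ≤ ω) (hd : ‖a - a'‖ ≤ d) (he : ‖w - w'‖ ≤ e) :
    ‖quadPart b₀ b₁ a w - quadPart b₀ b₁ a' w'‖
      ≤ 2 * (M * α * d) + 2 * (M * α * e + M * ω * d) := by
  have e1 : quadPart b₀ b₁ a w - quadPart b₀ b₁ a' w'
      = (b₁ (a - a') a + b₁ a' (a - a')) + ((b₀ (a - a') w + b₀ a' (w - w'))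
        + (b₀ (w - w') a + b₀ w' (a - a'))) := by
    simp only [quadPart, map_sub, sub_apply]
    abel
  have i1 := b₁.le_of_opNorm₂_le_of_le h₁ hd ha
  have i2 := b₁.le_of_opNorm₂_le_of_le h₁ ha' hd
  have i3 := b₀.le_of_opNorm₂_le_of_le h₀ hd hw
  have i4 := b₀.le_of_opNorm₂_le_of_le h₀ ha' he
  have i5 := b₀.le_of_opNorm₂_le_of_le h₀ he ha
  have i6 := b₀.le_of_opNorm₂_le_of_le h₀ hw' hd
  rw [e1]
  refine (norm_add_le _ _).trans ((add_le_add (norm_add_le _ _) ((norm_add_le _ _).trans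
    (add_le_add (norm_add_le _ _) (norm_add_le _ _)))).trans ?_)
  linarith

end Chains

/-! ### Choice of the constants and conclusion -/

/-- One factor M bounds the projection, another the inverse of Sᵢ, and M(8M + 10)r is the Lipschitz
constant of the quadratic part on the ball of radius r. The product is the contraction constant of
the top system. -/
theorem smallness_estimates {M r : ℝ} (hM : 0 ≤ M) (hr : r = 1 / (100 * (M + 1) ^ 4)) :
    M * M * (M * (8 * M + 10) * r) ≤ 1 / 8 := by
  have h1 : r * (100 * (M + 1) ^ 4) = 1 := by
    rw [hr]
    field_simp
  have hr0 : 0 ≤ r := by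
    rw [hr]
    positivity
  have h2 : M * M * (M * (8 * M + 10)) ≤ 10 * (M + 1) ^ 4 := by
    have h3 : 0 ≤ M ^ 2 := by positivity
    have h4 : 0 ≤ M ^ 3 := by positivity
    have h5 : 0 ≤ M ^ 4 := by positivity
    nlinarith
  nlinarith [mul_le_mul_of_nonneg_right h2 hr0]

variable {𝕜 : Type*} [RCLike 𝕜]
  {B : Type*} [NormedAddCommGroup B] [NormedSpace 𝕜 B] [CompleteSpace B]
  {B' : Type*} [NormedAddCommGroup B'] [NormedSpace 𝕜 B'] [CompleteSpace B']

theorem exists_solution_in_cone {k : ℕ} (hk : 3 ≤ k)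
    {l' : Fin (k + 1)} (hkl : (l' : ℕ) + 1 = k) {M r δ : ℝ}
    (hr : r = 1 / (100 * (|M| + 1) ^ 4)) (hδ : δ = r / (8 * (|M| + 1) ^ 2))
    {q : ℕ∞} (hq : 1 ≤ q) {G : B → B'}
    (hG : ContDiff 𝕜 ((q + 2 * k : ℕ∞) : WithTop ℕ∞) G) {ρ : ℝ} (hρ : 0 < ρ) {z : 𝕜 → B}
    (hz : ContDiffOn 𝕜 ((q + 2 * k : ℕ∞) : WithTop ℕ∞) z (Metric.ball 0 ρ)) (hz0 : z 0 = 0)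
    {D : JordanSplitting (linearization G z) k} (C : ChainFamily D)
    (hM : C.BoundedBy (curvature G z 0) (deriv (curvature G z) 0) M)
    {bbar : 𝕜 → B'} (hbbar : ContinuousAt bbar 0)
    (hGz : ∀ ε ∈ Metric.ball (0 : 𝕜) ρ, G (z ε) = ε ^ (2 * k - 1) • bbar ε)
    (hsmall : ‖(directProj D.R D.isInternal_R l' (bbar 0) : B')
      + (directProj D.R D.isInternal_R (Fin.last k) (bbar 0) : B')‖ < δ)
    (hcurv : ∀ u ∈ D.Nc (Fin.last k), ∀ m ∈ D.N, curvature G z 0 (u + m) (u + m) = 0) :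
    ∃ ε₀ > (0 : ℝ), ε₀ ≤ ρ ∧
      ∃ ν : 𝕜 × D.N → ∀ i, D.Nc i,
        ContDiffOn 𝕜 (q : WithTop ℕ∞) ν (Metric.ball 0 ε₀ ×ˢ Metric.ball 0 r) ∧
        (∀ (ε : 𝕜) (m : D.N), ‖ε‖ < ε₀ → ‖m‖ < r →
          (∀ i : Fin (k + 1), k ≤ (i : ℕ) + 1 → ‖ν (ε, m) i‖ < r) ∧
          G (C.conePoint z ε (ν (ε, m)) m) = 0) ∧
        (∀ ρ > (0 : ℝ), ∃ ε₁ > (0 : ℝ), ε₁ ≤ ε₀ ∧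
          ∀ (ε : 𝕜) (n : ∀ i, D.Nc i) (m : D.N), ε ≠ 0 → ‖ε‖ < ε₁ → ‖m‖ < r →
            (∀ i : Fin (k + 1), k ≤ (i : ℕ) + 1 → ‖n i‖ < r) →
            (∀ i : Fin (k + 1), (i : ℕ) + 1 < k → ‖n i‖ < ρ) →
            (G (C.conePoint z ε n m) = 0 ↔ n = ν (ε, m))) := by
  have hM0 : 0 ≤ M := (norm_nonneg _).trans hM.φ_one
  rw [abs_of_nonneg hM0] at hr hδ
  have hr0 : 0 < r := by rw [hr]; positivity
  have hest := smallness_estimates hM0 hr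
  have hδM : M * (M * δ) ≤ r / 8 := by
    have h1 : δ * (8 * (M + 1) ^ 2) = r := by
      rw [hδ]
      field_simp
    have h2 : 0 ≤ δ := by rw [hδ]; positivity
    nlinarith [mul_nonneg h2 hM0]
  obtain ⟨F, hF, hGF, hT, hF0⟩ := C.exists_reduced_equation hk hkl hq hG hρ hz hz0 hbbar hGz hcurv
  have _ : ∀ i, CompleteSpace (D.Nc i) := fun i => (D.isClosed_Nc i).completeSpace_coe
  have _ : CompleteSpace D.N := D.isClosed_N.completeSpace_coe
  let l : Fin (k + 1) := Fin.last k
  have hl : k ≤ (l : ℕ) + 1 := by simp [l]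
  have hl' : k ≤ (l' : ℕ) + 1 := hkl.ge
  have htop : ∀ i : Fin (k + 1), k ≤ (i : ℕ) + 1 → i = l' ∨ i = l := by
    intro i hi
    by_cases h : (i : ℕ) = k
    · exact Or.inr (Fin.ext h)
    · exact Or.inl (Fin.ext (by omega))
  let a : (∀ i, D.Nc i) → D.N → B := fun x m => (x l : B) + m
  let w : (∀ i, D.Nc i) → D.N → B := fun x m => C.φ 1 (a x m) + (x l' : B)
  let Q : (∀ i, D.Nc i) → D.N → B' := fun x m =>
    quadPart (curvature G z 0) (deriv (curvature G z) 0) (a x m) (w x m)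
  have ha : ∀ x m, (∀ i : Fin (k + 1), k ≤ (i : ℕ) + 1 → ‖x i‖ ≤ r) → ‖m‖ ≤ r →
      ‖a x m‖ ≤ 2 * r := fun x m hx hm => by
    have h1 : ‖(x l : B)‖ ≤ r := hx l hl
    have h2 : ‖(m : B)‖ ≤ r := hm
    exact (norm_add_le _ _).trans (by linarith)
  have hw : ∀ x m, (∀ i : Fin (k + 1), k ≤ (i : ℕ) + 1 → ‖x i‖ ≤ r) → ‖m‖ ≤ r →
      ‖w x m‖ ≤ (2 * M + 1) * r := fun x m hx hm => by
    have h1 : ‖(x l' : B)‖ ≤ r := hx l' hl'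
    have h2 := (C.φ 1).le_of_opNorm_le_of_le hM.φ_one (ha x m hx hm)
    exact (norm_add_le _ _).trans (by linarith)
  have hQ : ∀ x m, (∀ i : Fin (k + 1), k ≤ (i : ℕ) + 1 → ‖x i‖ ≤ r) → ‖m‖ ≤ r →
      ‖Q x m‖ ≤ M * (8 * M + 10) * r * r := fun x m hx hm => by
    refine (norm_quadPart_le hM.curv_zero hM.curv_one (ha x m hx hm) (hw x m hx hm)).trans ?_
    have h1 : 0 ≤ M * (r * r) := by positivity
    nlinarith
  have hQsub : ∀ x y m d, (∀ i : Fin (k + 1), k ≤ (i : ℕ) + 1 → ‖x i‖ ≤ r) →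
      (∀ i : Fin (k + 1), k ≤ (i : ℕ) + 1 → ‖y i‖ ≤ r) → ‖m‖ ≤ r →
      (∀ i : Fin (k + 1), k ≤ (i : ℕ) + 1 → ‖x i - y i‖ ≤ d) →
      ‖Q x m - Q y m‖ ≤ M * (8 * M + 10) * r * d := by
    intro x y m d hx hy hm hd
    have h1 : ‖a x m - a y m‖ ≤ d := by
      have e : a x m - a y m = ((x l - y l : D.Nc l) : B) := by
        simp only [a, Submodule.coe_sub]
        abel
      rw [e]
      exact hd l hl
    have h2 : ‖w x m - w y m‖ ≤ (M + 1) * d := by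
      have e : w x m - w y m = C.φ 1 (a x m - a y m) + ((x l' - y l' : D.Nc l') : B) := by
        simp only [w, Submodule.coe_sub, map_sub]
        abel
      have h3 : ‖((x l' - y l' : D.Nc l') : B)‖ ≤ d := hd l' hl'
      have h4 := (C.φ 1).le_of_opNorm_le_of_le hM.φ_one h1
      rw [e]
      exact (norm_add_le _ _).trans (by linarith)
    refine (norm_quadPart_sub_le hM.curv_zero hM.curv_one (ha x m hx hm) (hw x m hx hm)
      (ha y m hy hm) (hw y m hy hm) h1 h2).trans (le_of_eq ?_)
    ring
  have hTi : ∀ i : Fin (k + 1), k ≤ (i : ℕ) + 1 → ∀ y,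
      ‖C.diagEquiv.symm y i‖ ≤ M * ‖D.projR i y‖ := fun i hi y => hM.S_symm i hi _
  have hP : ∀ i : Fin (k + 1), k ≤ (i : ℕ) + 1 → ∀ y, ‖D.projR i y‖ ≤ M * ‖y‖ := fun i hi y => by
    rw [← D.directProj_R]
    exact hM.proj i hi y
  have hTP : ∀ i : Fin (k + 1), k ≤ (i : ℕ) + 1 → ∀ y,
      ‖C.diagEquiv.symm y i‖ ≤ M * M * ‖y‖ := fun i hi y => by
    rw [mul_assoc]
    exact (hTi i hi y).trans (mul_le_mul_of_nonneg_left (hP i hi y) hM0)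
  have hbb : ∀ i : Fin (k + 1), k ≤ (i : ℕ) + 1 →
      ‖C.diagEquiv.symm (bbar 0) i‖ ≤ r / 8 := fun i hi => by
    have hne : l' ≠ l := fun e => by
      have := congrArg Fin.val e
      simp only [l, Fin.val_last] at this
      omega
    -- Smallness is given for the sum of the two projections; projecting once more recovers each of
    -- them, at the cost of the second factor M in `hδM`.
    have e : D.projR i (bbar 0) = D.projR i ((D.projR l' (bbar 0) : B') + D.projR l (bbar 0)) := by
      rcases htop i hi with rfl | rfl
      · rw [map_add, D.projR_coe, D.projR_coe_of_ne hne, add_zero]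
      · rw [map_add, D.projR_coe, D.projR_coe_of_ne hne.symm, zero_add]
    have h1 : ‖((D.projR l' (bbar 0) : B') + D.projR l (bbar 0))‖ ≤ δ := by
      rw [← D.directProj_R, ← D.directProj_R]
      exact hsmall.le
    refine (hTi i hi _).trans (le_trans (mul_le_mul_of_nonneg_left ?_ hM0) hδM)
    rw [e]
    exact (hP i hi _).trans (mul_le_mul_of_nonneg_left h1 hM0)
  set τ := ‖(C.diagEquiv.symm : B' →L[𝕜] ∀ i, D.Nc i)‖ with hτ
  have hτ0 : 0 ≤ τ := norm_nonneg _
  have hτle : ∀ y i, ‖C.diagEquiv.symm y i‖ ≤ τ * ‖y‖ := fun y i =>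
    (norm_le_pi_norm _ i).trans ((C.diagEquiv.symm : B' →L[𝕜] ∀ i, D.Nc i).le_opNorm y)
  set κ := M * (8 * M + 10) * r with hκ
  have hκ0 : 0 ≤ κ := by positivity
  have hsub : ∀ x y m i, C.diagEquiv.symm (bbar 0 + Q x m) i - C.diagEquiv.symm (bbar 0 + Q y m) i
      = C.diagEquiv.symm (Q x m - Q y m) i := fun x y m i => by
    rw [map_add, map_add, map_sub]
    simp only [Pi.add_apply, Pi.sub_apply]
    abel
  have hq' : (q : WithTop ℕ∞) ≠ 0 := by
    have : q ≠ 0 := fun h => by rw [h] at hq; exact absurd hq (by norm_num)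
    exact_mod_cast this
  obtain ⟨ε₀, hε₀, hε₀ρ, ν, hν, hν0, hνu⟩ := exists_solution_of_triangular
    (fun i : Fin (k + 1) => k ≤ (i : ℕ) + 1) hq' hρ hF hT C.diagEquiv
    -- The first summand of C bounds the lower components and the second their Lipschitz constant. C
    -- may depend on all the data, since it affects only ε₀ and never r or δ.
    (E := fun x m => bbar 0 + Q x m) hF0 (r := r) (C := τ * (‖bbar 0‖ + κ * r) + τ * κ) hr0
    (by positivity)
    (fun x m hx hm i hi => by
      rw [map_add, Pi.add_apply]
      refine (norm_add_le _ _).trans ?_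
      have h1 := (hTP i hi (Q x m)).trans
        (mul_le_mul_of_nonneg_left (hQ x m hx hm) (mul_nonneg hM0 hM0))
      have h2 := mul_le_mul_of_nonneg_right hest hr0.le
      linarith [hbb i hi])
    (fun x m hx hm i => by
      have h1 : ‖bbar 0 + Q x m‖ ≤ ‖bbar 0‖ + κ * r :=
        (norm_add_le _ _).trans (by linarith [hQ x m hx hm])
      have h2 := (hτle (bbar 0 + Q x m) i).trans (mul_le_mul_of_nonneg_left h1 hτ0)
      linarith [mul_nonneg hτ0 hκ0])
    (fun x y m d hx hy hm hd i hi => by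
      rw [hsub]
      have hd0 : 0 ≤ d := (norm_nonneg _).trans (hd i hi)
      have h1 := (hTP i hi (Q x m - Q y m)).trans
        (mul_le_mul_of_nonneg_left (hQsub x y m d hx hy hm hd) (mul_nonneg hM0 hM0))
      have h2 := mul_le_mul_of_nonneg_right hest hd0
      linarith)
    (fun x y m d hx hy hm hd i => by
      rw [hsub]
      have hd0 : 0 ≤ d := (norm_nonneg _).trans (hd l hl)
      have h1 := (hτle (Q x m - Q y m) i).trans
        (mul_le_mul_of_nonneg_left (hQsub x y m d hx hy hm hd) hτ0)
      have h2 : 0 ≤ τ * (‖bbar 0‖ + κ * r) * d := by positivity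
      linarith)
  have hball : ∀ ε : 𝕜, ‖ε‖ < ε₀ → ε ∈ Metric.ball (0 : 𝕜) ρ := fun ε h =>
    mem_ball_zero_iff.2 (h.trans_le hε₀ρ)
  refine ⟨ε₀, hε₀, hε₀ρ, ν, hν, fun ε m h1 h2 => ?_, fun ρ' hρ' => ?_⟩
  · obtain ⟨h3, h4⟩ := hν0 ε m h1 h2
    exact ⟨h3, by rw [hGF ε (hball ε h1), h4, smul_zero]⟩
  · obtain ⟨ε₁, hε₁, hε₁₀, h⟩ := hνu ρ' hρ'
    refine ⟨ε₁, hε₁, hε₁₀, fun ε n m h0 h1 h2 h3 h4 => ⟨fun h5 => ?_, fun h5 => ?_⟩⟩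
    · rw [hGF ε (hball ε (h1.trans_le hε₁₀))] at h5
      exact h ε n m h1 h2 h3 (fun i hi => h4 i (not_le.1 hi))
        ((smul_eq_zero.1 h5).resolve_left (pow_ne_zero _ h0))
    · rw [h5, hGF ε (hball ε (h1.trans_le hε₁₀)), (hν0 ε m (h1.trans_le hε₁₀) h2).2, smul_zero]

end JordanCone

theorem corollary3 {𝕜 : Type*} [RCLike 𝕜]
    {B : Type*} [NormedAddCommGroup B] [NormedSpace 𝕜 B] [CompleteSpace B]
    {B' : Type*} [NormedAddCommGroup B'] [NormedSpace 𝕜 B'] [CompleteSpace B']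
    (k : ℕ) (hk : 3 ≤ k) (M : ℝ) :
    -- the smallness constants depend only on the spaces, on `k` and on the bound `M`
    ∃ δ > (0 : ℝ), ∃ r > (0 : ℝ),
      ∀ (q : ℕ∞) (_ : 1 ≤ q)
        (G : B → B') (_ : ContDiff 𝕜 ((q + 2 * k : ℕ∞) : WithTop ℕ∞) G)
        (U : Set 𝕜) (_ : IsOpen U) (_ : (0 : 𝕜) ∈ U)
        (z : 𝕜 → B) (_ : ContDiffOn 𝕜 ((q + 2 * k : ℕ∞) : WithTop ℕ∞) z U) (_ : z 0 = 0)
        (_ : IsKSurjective (linearization G z) k)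
        (D : JordanSplitting (linearization G z) k),
        -- the isomorphisms `Sᵢ` and the polynomial family `pₖ` exist, and for all of them:
        Nonempty (ChainFamily D) ∧
        ∀ (C : ChainFamily D)
          (_ : C.BoundedBy (curvature G z 0) (deriv (curvature G z) 0) M)
          (bbar : 𝕜 → B') (_ : ContinuousAt bbar 0)
          (_ : ∀ ε ∈ U, G (z ε) = ε ^ (2 * k - 1) • bbar ε)
          (_ : ‖(directProj D.R D.isInternal_R ⟨k - 1, by omega⟩ (bbar 0) : B')
              + (directProj D.R D.isInternal_R (Fin.last k) (bbar 0) : B')‖ < δ)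
          (_ : ∀ u ∈ D.Nc (Fin.last k), ∀ m ∈ D.N, curvature G z 0 (u + m) (u + m) = 0),
          ∃ ε₀ > (0 : ℝ), Metric.ball (0 : 𝕜) ε₀ ⊆ U ∧
            ∃ ν : 𝕜 × D.N → ∀ i, D.Nc i,
              ContDiffOn 𝕜 (q : WithTop ℕ∞) ν (Metric.ball 0 ε₀ ×ˢ Metric.ball 0 r) ∧
              -- the points given by `ν` lie in the cone and are zeros of `G`
              (∀ (ε : 𝕜) (m : D.N), ‖ε‖ < ε₀ → ‖m‖ < r →
                (∀ i : Fin (k + 1), k ≤ (i : ℕ) + 1 → ‖ν (ε, m) i‖ < r) ∧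
                G (C.conePoint z ε (ν (ε, m)) m) = 0) ∧
              -- the cone contains no other zeros of `G`; the components
              -- of index below `k` may range over an arbitrarily large ball
              (∀ ρ > (0 : ℝ), ∃ ε₁ > (0 : ℝ), ε₁ ≤ ε₀ ∧
                ∀ (ε : 𝕜) (n : ∀ i, D.Nc i) (m : D.N), ε ≠ 0 → ‖ε‖ < ε₁ → ‖m‖ < r →
                  (∀ i : Fin (k + 1), k ≤ (i : ℕ) + 1 → ‖n i‖ < r) →
                  (∀ i : Fin (k + 1), (i : ℕ) + 1 < k → ‖n i‖ < ρ) →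
                  (G (C.conePoint z ε n m) = 0 ↔ n = ν (ε, m))) := by
  -- The absolute value keeps δ and r positive for every real M; for negative M the bound on `φ 1`
  -- cannot hold.
  refine ⟨1 / (100 * (|M| + 1) ^ 4) / (8 * (|M| + 1) ^ 2), by positivity,
    1 / (100 * (|M| + 1) ^ 4), by positivity, ?_⟩
  intro q hq G hG U hU h0U z hz hz0 _ D
  obtain ⟨ρ, hρ, hρU⟩ := Metric.isOpen_iff.1 hU 0 h0U
  have hz' := hz.mono hρU
  refine ⟨nonempty_chainFamily_of_contDiff hk hG hρ hz' D, ?_⟩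
  intro C hM bbar hbbar hGz hsmall hcurv
  obtain ⟨ε₀, hε₀, hε₀ρ, ν, hν⟩ := exists_solution_in_cone hk (Nat.sub_add_cancel (by omega)) rfl rfl hq hG hρ hz' hz0 C hM hbbar
    (fun ε hε => hGz ε (hρU hε)) hsmall hcurv
  exact ⟨ε₀, hε₀, (Metric.ball_subset_ball hε₀ρ).trans hρU, ν, hν⟩
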